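/- **Setting.** Let $d\in\mathbb N$ and $a<b$. Let $P_0,P_1\in\mathbb R^{d\times d}$ with $P_0^\top=-P_0$, $P_1^\top=P_1$ and $P_1$ invertible. Let $\mathcal H\colon(a,b)\to\mathbb R^{d\times d}$ be measurable, symmetric, bounded, and bounded below by $c\,1_d$ for some $c>0$, and let $W\in\mathbb R^{d\times 2d}$ have rank $d$. Let $H$ be $L^2((a,b);\mathbb C^d)$ with the norm $\|u\|_H=\|\mathcal H^{1/2}u\|_{L^2}$, that is, with the inner product $\langle u,v\rangle_H=\int_a^b\langle u(x),\mathcal H(x)v(x)\rangle\,dx$. Let $\mathcal A$ be the operator in $H$ given by $$\operatorname{dom}\mathcal A=\Big\{u\in H:\ \mathcal Hu\in H^1,\ W\begin{bmatrix}(\mathcal Hu)(b)\\(\mathcal Hu)(a)\end{bmatrix}=0\Big\},\qquad \mathcal Au=P_1(\mathcal Hu)'+P_0\mathcal Hu,$$ and assume that $\mathcal A$ is accretive. Let $S\colon L^2((a,b);\mathbb C^d)\to H$, $Su=\mathcal H^{-1}u$. For $t\in\mathbb R$ let $\Phi_t\colon[a,b]\to\mathbb C^{d\times d}$ be the solution of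 $$\Phi_t'(x)=-P_1^{-1}(it\mathcal H(x)^{-1}+P_0)\Phi_t(x),\qquad \Phi_t(a)=1_d,$$ and put $$B_t=\sup_{x\in[a,b]}\|\Phi_t(x)\|,\qquad B=\sup_{t\in\mathbb R}B_t,\qquad T_t=W\begin{bmatrix}\Phi_t(b)\\1_d\end{bmatrix}\in\mathbb C^{d\times d}.$$ Let $W^+=W^\top(WW^\top)^{-1}$ be the Moore–Penrose inverse of $W$. Matrices carry the spectral norm, $\|\mathcal H\|_\infty=\operatorname{ess\,sup}_{x}\|\mathcal H(x)\|$, $\|S\|$ is the operator norm from $L^2$ to $H$, and $\|R(it,-\mathcal A)\|$ is the operator norm of $(it+\mathcal A)^{-1}$ on $H$. **Theorem.** Assume that $i\mathbb R\subseteq\rho(\mathcal A)$ and $B<\infty$. Then, for each $t\in\mathbb R$, the matrix $T_t$ is invertible, $$\|T_t^{-1}\|\le C\big(\|R(it,-\mathcal A)\|+1\big)\qquad\text{and}\qquad \|R(it,-\mathcal A)\|\le\widetilde C\big(\|T_t^{-1}\|+1\big),$$ where $$C=\Big(\frac{1}{(b-a)^{3/2}}\|P_1\|^2\|P_1^{-1}\|^2B^3(1+B)+1\Big)\|W^+\|\max\big\{(b-a)^{1/2}\|\mathcal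 H\|_\infty\|P_1\|,\,1\big\},$$ $$\widetilde C=(b-a)\,B^2\,\|S\|^2\,\|P_1\|\,\|P_1^{-1}\|^2\max\big\{B\|W\|,\,(b-a)^{1/2}\big\}.$$ -/

import Mathlib

open MeasureTheory Set Filter
open scoped Matrix ENNReal Matrix.Norms.L2Operator

noncomputable section

namespace PortHam

/-- A real matrix, regarded as a complex matrix. -/
abbrev cmat {m n : Type*} (A : Matrix m n ℝ) : Matrix m n ℂ := A.map Complex.ofReal

/-! ### Resolvents of unbounded operators -/

section Resolvent

variable {H : Type*} [NormedAddCommGroup H] [InnerProductSpace ℂ H]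

/-- The bounded operator `R` is a two-sided inverse of `z - A : dom A → H`. -/
def IsResolvent (A : H →ₗ.[ℂ] H) (z : ℂ) (R : H →L[ℂ] H) : Prop :=
  (∀ u : A.domain, R (z • (u : H) - A u) = u) ∧
    ∀ f : H, ∃ u : A.domain, (u : H) = R f ∧ z • (u : H) - A u = f

/-- The resolvent set `ρ(A)`. -/
def resolventSetOf (A : H →ₗ.[ℂ] H) : Set ℂ := {z | ∃ R : H →L[ℂ] H, IsResolvent A z R}

lemma IsResolvent.unique {A : H →ₗ.[ℂ] H} {z : ℂ} {R R' : H →L[ℂ] H}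
    (h : IsResolvent A z R) (h' : IsResolvent A z R') : R = R' := by
  ext f
  obtain ⟨u, hu, hf⟩ := h.2 f
  rw [← hu, ← h'.1 u, hf]

open Classical in
/-- The resolvent `R(z, A) = (z - A)⁻¹` for `z ∈ ρ(A)` (and `0` otherwise). -/
def resolventOp (A : H →ₗ.[ℂ] H) (z : ℂ) : H →L[ℂ] H :=
  if h : z ∈ resolventSetOf A then Classical.choose h else 0

lemma resolventOp_spec {A : H →ₗ.[ℂ] H} {z : ℂ} (h : z ∈ resolventSetOf A) :
    IsResolvent A z (resolventOp A z) := by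
  rw [resolventOp, dif_pos h]
  exact Classical.choose_spec h

end Resolvent

/-! ### Linear differential equations with measurable coefficients -/

/-- Existence of the fundamental solution of a linear differential equation with bounded measurable
coefficients. -/
lemma exists_linear_ode {R : Type*} [NormedRing R] [NormedAlgebra ℝ R] [CompleteSpace R] {a b : ℝ}
    (A : ℝ → R) (hm : AEStronglyMeasurable A (volume.restrict (Ioc a b)))
    {K : ℝ} (hK0 : 0 ≤ K) (hK : ∀ᵐ x ∂volume.restrict (Ioc a b), ‖A x‖ ≤ K) :
    ∃ F : ℝ → R, ContinuousOn F (Icc a b) ∧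
      ∀ x ∈ Icc a b, F x = 1 + ∫ y in a..x, A y * F y := by
  let T : ℕ → ℝ → R := fun n => Nat.rec (fun _ => 1) (fun _ g x => ∫ y in a..x, A y * g y) n
  have T0 : ∀ x, T 0 x = 1 := fun _ => rfl
  have Ts : ∀ n x, T (n + 1) x = ∫ y in a..x, A y * T n y := fun _ _ => rfl
  have hmeas : ∀ g : ℝ → R, ContinuousOn g (Icc a b) →
      AEStronglyMeasurable (fun y => A y * g y) (volume.restrict (Ioc a b)) := fun g hg =>
    hm.mul ((hg.mono Ioc_subset_Icc_self).aestronglyMeasurable measurableSet_Ioc)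
  have hT : ∀ n, ContinuousOn (T n) (Icc a b) ∧
      ∀ x ∈ Icc a b, ‖T n x‖ ≤ ‖(1 : R)‖ * ((K * (x - a)) ^ n / n.factorial) := by
    intro n
    induction n with
    | zero =>
      refine ⟨continuousOn_const, fun x _ => ?_⟩
      simp [T0]
    | succ n ih =>
      obtain ⟨hc, hb⟩ := ih
      have hbound : ∀ᵐ y ∂volume.restrict (Ioc a b), ‖A y * T n y‖
          ≤ K * (‖(1 : R)‖ * ((K * (y - a)) ^ n / n.factorial)) := by
        filter_upwards [hK, ae_restrict_mem measurableSet_Ioc] with y h1 h2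
        exact (norm_mul_le _ _).trans
          (mul_le_mul h1 (hb y (Ioc_subset_Icc_self h2)) (norm_nonneg _) hK0)
      have hgc : Continuous fun y : ℝ => K * (‖(1 : R)‖ * ((K * (y - a)) ^ n / n.factorial)) := by
        fun_prop
      have hint : IntegrableOn (fun y => A y * T n y) (Ioc a b) volume :=
        Integrable.mono' (hgc.integrableOn_Ioc) (hmeas _ hc) hbound
      refine ⟨?_, fun x hx => ?_⟩
      · have := intervalIntegral.continuousOn_primitive (μ := volume)
          (f := fun y => A y * T n y) (a := a) (b := b) (by
            rwa [integrableOn_Icc_iff_integrableOn_Ioc])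
        refine this.congr fun x hx => ?_
        rw [Ts, intervalIntegral.integral_of_le hx.1]
      · rw [Ts]
        refine (intervalIntegral.norm_integral_le_of_norm_le hx.1 ?_
          (hgc.intervalIntegrable a x)).trans (le_of_eq ?_)
        · rw [ae_restrict_iff' measurableSet_Ioc] at hbound
          filter_upwards [hbound] with y hy hyx
          exact hy ⟨hyx.1, hyx.2.trans hx.2⟩
        · have : ∀ y : ℝ, K * (‖(1 : R)‖ * ((K * (y - a)) ^ n / n.factorial))
              = (K ^ (n + 1) * ‖(1 : R)‖ / n.factorial) * (y - a) ^ n := by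
            intro y
            rw [mul_pow]
            ring
          simp only [this]
          rw [intervalIntegral.integral_const_mul,
            intervalIntegral.integral_comp_sub_right (fun y : ℝ => y ^ n) a, integral_pow,
            Nat.factorial_succ]
          have h1 : (n.factorial : ℝ) ≠ 0 := by positivity
          push_cast
          simp only [mul_pow, sub_self, ne_eq, Nat.succ_ne_zero, not_false_eq_true, zero_pow]
          field_simp
          ring
  have hu : Summable fun n : ℕ => ‖(1 : R)‖ * ((K * (b - a)) ^ n / n.factorial) :=
    (Real.summable_pow_div_factorial _).mul_left _
  have hTu : ∀ n, ∀ x ∈ Icc a b, ‖T n x‖ ≤ ‖(1 : R)‖ * ((K * (b - a)) ^ n / n.factorial) := by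
    intro n x hx
    refine ((hT n).2 x hx).trans ?_
    have : 0 ≤ x - a := sub_nonneg.2 hx.1
    have := hx.2
    gcongr
  have hF : ∀ x ∈ Icc a b, HasSum (fun n => T n x) (∑' n, T n x) := fun x hx =>
    (Summable.of_norm_bounded hu fun n => hTu n x hx).hasSum
  refine ⟨fun x => ∑' n, T n x, continuousOn_tsum (fun n => (hT n).1) hu hTu, fun x hx => ?_⟩
  have h1 : HasSum (fun n => ∫ y in a..x, A y * T n y) (∫ y in a..x, A y * ∑' n, T n y) := by
    have hsub : uIoc a x ⊆ Ioc a b := by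
      rw [uIoc_of_le hx.1]
      exact Ioc_subset_Ioc_right hx.2
    refine intervalIntegral.hasSum_integral_of_dominated_convergence
      (fun n _ => K * (‖(1 : R)‖ * ((K * (b - a)) ^ n / n.factorial)))
      (fun n => (hmeas _ (hT n).1).mono_measure (Measure.restrict_mono hsub le_rfl)) ?_ ?_ ?_ ?_
    · intro n
      rw [ae_restrict_iff' measurableSet_Ioc] at hK
      filter_upwards [hK] with y hy hyx
      exact (norm_mul_le _ _).trans (mul_le_mul (hy (hsub hyx))
        (hTu n y (Ioc_subset_Icc_self (hsub hyx))) (norm_nonneg _) hK0)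
    · exact ae_of_all _ fun y _ => hu.mul_left K
    · exact intervalIntegrable_const
    · exact ae_of_all _ fun y hy => (hF y (Ioc_subset_Icc_self (hsub hy))).mul_left _
  have h2 := (hasSum_nat_add_iff' (f := fun n => T n x) 1).2 (hF x hx)
  have h3 := h2.unique h1
  simp only [Finset.sum_range_one, T0] at h3
  rw [← h3]
  abel

/-! ### The data of a port-Hamiltonian system -/

/-- The data of a port-Hamiltonian system of dimension `d` on the interval `(a, b)`. -/
structure System (d : ℕ) where
  a : ℝ
  b : ℝ
  hab : a < b
  P0 : Matrix (Fin d) (Fin d) ℝ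
  P1 : Matrix (Fin d) (Fin d) ℝ
  P0_skew : P0ᵀ = -P0
  P1_symm : P1ᵀ = P1
  P1_inv : IsUnit P1
  /-- the Hamiltonian density; only its values on `(a, b)` matter -/
  Ham : ℝ → Matrix (Fin d) (Fin d) ℝ
  Ham_meas : ∀ i j, Measurable fun x => Ham x i j
  Ham_symm : ∀ x ∈ Ioo a b, (Ham x)ᵀ = Ham x
  Ham_upper : ∃ K : ℝ, ∀ x ∈ Ioo a b, ‖Ham x‖ ≤ K
  Ham_lower : ∃ c : ℝ, 0 < c ∧ ∀ x ∈ Ioo a b, ∀ ξ : Fin d → ℝ,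
    c * (ξ ⬝ᵥ ξ) ≤ ξ ⬝ᵥ (Ham x *ᵥ ξ)
  /-- the matrix of the boundary conditions -/
  W : Matrix (Fin d) (Fin d ⊕ Fin d) ℝ
  W_rank : W.rank = d

variable {d : ℕ}

/-- `ℂ^d` with the Euclidean norm. -/
abbrev Cd (d : ℕ) : Type := EuclideanSpace ℂ (Fin d)

/-- A complex matrix as an operator on `ℂ^d`. -/
abbrev act (A : Matrix (Fin d) (Fin d) ℂ) : Cd d →L[ℂ] Cd d :=
  Matrix.toEuclideanCLM (n := Fin d) (𝕜 := ℂ) A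

lemma memLp_top_act {μ : Measure ℝ} {A : ℝ → Matrix (Fin d) (Fin d) ℂ}
    (hm : ∀ i j, Measurable fun x => A x i j) {K : ℝ} (hK : ∀ᵐ x ∂μ, ‖A x‖ ≤ K) :
    MemLp (fun x => act (A x)) ∞ μ := by
  refine memLp_top_of_bound ?_ K ?_
  · have h : (fun x => act (A x)) = fun x => ∑ i, ∑ j, A x i j • act (Matrix.single i j (1 : ℂ)) := by
      funext x
      conv_lhs => rw [Matrix.matrix_eq_sum_single (A x)]
      simp only [map_sum, act]
      refine Finset.sum_congr rfl fun i _ => Finset.sum_congr rfl fun j _ => ?_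
      rw [← map_smul, Matrix.smul_single, smul_eq_mul, mul_one]
    rw [h]
    refine Measurable.aestronglyMeasurable ?_
    refine Finset.measurable_sum _ fun i _ => Finset.measurable_sum _ fun j _ => ?_
    exact (hm i j).smul_const _
  · filter_upwards [hK] with x hx
    rwa [← Matrix.cstar_norm_def]

lemma norm_cmat_le (A : Matrix (Fin d) (Fin d) ℝ) : ‖cmat A‖ ≤ ‖A‖ := by
  rw [Matrix.cstar_norm_def]
  refine ContinuousLinearMap.opNorm_le_bound _ (norm_nonneg _) fun z => ?_
  have key : ∀ y : Fin d → ℝ, ∑ i, (A *ᵥ y) i ^ 2 ≤ ‖A‖ ^ 2 * ∑ i, y i ^ 2 := by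
    intro y
    have h := Matrix.l2_opNorm_mulVec A (WithLp.toLp 2 y)
    have h2 := pow_le_pow_left₀ (norm_nonneg _) h 2
    rw [mul_pow, EuclideanSpace.norm_sq_eq, EuclideanSpace.norm_sq_eq] at h2
    simpa using h2
  refine le_of_sq_le_sq ?_ (by positivity)
  rw [mul_pow, EuclideanSpace.norm_sq_eq, EuclideanSpace.norm_sq_eq]
  have h1 : ∀ i, ‖(act (cmat A) z) i‖ ^ 2
      = (A *ᵥ fun j => (z j).re) i ^ 2 + (A *ᵥ fun j => (z j).im) i ^ 2 := by
    intro i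
    have : (act (cmat A) z) i = ∑ j, (A i j : ℂ) * z j := by
      simp [act, Matrix.ofLp_toEuclideanCLM, Matrix.mulVec, dotProduct]
    rw [this, ← Complex.normSq_eq_norm_sq, Complex.normSq_apply]
    simp [Matrix.mulVec, dotProduct, sq]
  have h2 : ∀ i, ‖z i‖ ^ 2 = (z i).re ^ 2 + (z i).im ^ 2 := by
    intro i
    rw [← Complex.normSq_eq_norm_sq, Complex.normSq_apply]
    ring
  simp only [act] at h1
  simp only [h1, h2, Finset.sum_add_distrib, mul_add]
  exact add_le_add (key _) (key _)

lemma measurable_inv_entry {A : ℝ → Matrix (Fin d) (Fin d) ℝ}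
    (hm : ∀ i j, Measurable fun x => A x i j) (i j : Fin d) :
    Measurable fun x => (A x)⁻¹ i j := by
  have hdet : ∀ B : ℝ → Matrix (Fin d) (Fin d) ℝ, (∀ i j, Measurable fun x => B x i j) →
      Measurable fun x => (B x).det := by
    intro B hB
    simp only [Matrix.det_apply']
    exact Finset.measurable_sum _ fun σ _ =>
      (Finset.measurable_prod _ fun k _ => hB _ _).const_mul _
  simp only [Matrix.inv_def, Matrix.smul_apply, Ring.inverse_eq_inv', smul_eq_mul,
    Matrix.adjugate_apply]
  refine (hdet _ hm).inv.mul (hdet _ fun k l => ?_)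
  by_cases h : k = j
  · subst h
    simp
  · simpa [Matrix.updateRow_ne h] using hm k l

/-- Multiplication by a bounded measurable matrix-valued function, on `L²(μ; ℂ^d)`. -/
def multOp {μ : Measure ℝ} (A : ℝ → Matrix (Fin d) (Fin d) ℂ)
    (hA : MemLp (fun x => act (A x)) ∞ μ) : Lp (Cd d) 2 μ →L[ℂ] Lp (Cd d) 2 μ :=
  (ContinuousLinearMap.id ℂ (Cd d →L[ℂ] Cd d)).holderL μ ∞ 2 2 (hA.toLp _)

lemma multOp_coe {μ : Measure ℝ} (A : ℝ → Matrix (Fin d) (Fin d) ℂ)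
    (hA : MemLp (fun x => act (A x)) ∞ μ) (f : Lp (Cd d) 2 μ) :
    multOp A hA f =ᵐ[μ] fun x => act (A x) (f x) := by
  filter_upwards [(ContinuousLinearMap.id ℂ (Cd d →L[ℂ] Cd d)).coeFn_holder (r := 2)
    (hA.toLp _) f, hA.coeFn_toLp] with x h1 h2
  rw [multOp, ContinuousLinearMap.holderL_apply_apply, h1, h2]
  rfl

namespace System

variable (S : System d)

/-- Lebesgue measure on `(a, b)`. -/
abbrev μ : Measure ℝ := volume.restrict (Ioo S.a S.b)

/-- `L²((a, b); ℂ^d)` with its usual norm. -/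
abbrev L2 : Type := Lp (Cd d) 2 S.μ

lemma ae_mem : ∀ᵐ x ∂S.μ, x ∈ Ioo S.a S.b := ae_restrict_mem measurableSet_Ioo

lemma exists_inv_bound : ∃ K : ℝ, ∀ x ∈ Ioo S.a S.b, IsUnit (S.Ham x) ∧ ‖(S.Ham x)⁻¹‖ ≤ K := by
  obtain ⟨c, hc, h⟩ := S.Ham_lower
  refine ⟨c⁻¹, fun x hx => ?_⟩
  have hu : IsUnit (S.Ham x) := by
    rw [← Matrix.mulVec_injective_iff_isUnit]
    refine (injective_iff_map_eq_zero (S.Ham x).mulVecLin).2 fun ξ hξ => ?_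
    have h1 := h x hx ξ
    rw [Matrix.mulVecLin_apply] at hξ
    rw [hξ, dotProduct_zero] at h1
    have h2 : ξ ⬝ᵥ ξ ≤ 0 := by
      by_contra h3
      nlinarith [mul_pos hc (not_le.1 h3)]
    exact dotProduct_self_eq_zero.1 (le_antisymm h2 (Finset.sum_nonneg fun i _ => mul_self_nonneg _))
  refine ⟨hu, ?_⟩
  rw [Matrix.cstar_norm_def]
  refine ContinuousLinearMap.opNorm_le_bound _ (by positivity) fun z => ?_
  set y := Matrix.toEuclideanCLM (n := Fin d) (𝕜 := ℝ) (S.Ham x)⁻¹ z with hy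
  have h1 := h x hx y.ofLp
  have hz : S.Ham x *ᵥ y.ofLp = z.ofLp := by
    rw [hy, Matrix.ofLp_toEuclideanCLM, Matrix.mulVec_mulVec,
      Matrix.mul_nonsing_inv _ ((Matrix.isUnit_iff_isUnit_det _).1 hu), Matrix.one_mulVec]
  rw [hz] at h1
  have e1 : y.ofLp ⬝ᵥ y.ofLp = ‖y‖ ^ 2 := by
    rw [EuclideanSpace.norm_sq_eq]
    simp [dotProduct, sq]
  have e2 : y.ofLp ⬝ᵥ z.ofLp ≤ ‖y‖ * ‖z‖ := by
    have := real_inner_le_norm y z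
    rwa [EuclideanSpace.inner_eq_star_dotProduct, dotProduct_comm] at this
  rw [e1] at h1
  rcases (norm_nonneg y).eq_or_lt with h0 | h0
  · rw [← h0]
    positivity
  · rw [inv_mul_eq_div, le_div_iff₀ hc]
    have : ‖y‖ * (‖y‖ * c) ≤ ‖y‖ * ‖z‖ := by nlinarith
    exact le_of_mul_le_mul_left this h0

lemma memLp_Ham : MemLp (fun x => act (cmat (S.Ham x))) ∞ S.μ := by
  obtain ⟨K, hK⟩ := S.Ham_upper
  refine memLp_top_act (K := K) (fun i j => ?_) ?_
  · exact Complex.measurable_ofReal.comp (S.Ham_meas i j)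
  · filter_upwards [S.ae_mem] with x hx
    exact (norm_cmat_le _).trans (hK x hx)

lemma memLp_HamInv : MemLp (fun x => act (cmat (S.Ham x)⁻¹)) ∞ S.μ := by
  obtain ⟨K, hK⟩ := S.exists_inv_bound
  refine memLp_top_act (K := K) (fun i j => ?_) ?_
  · exact Complex.measurable_ofReal.comp (measurable_inv_entry S.Ham_meas i j)
  · filter_upwards [S.ae_mem] with x hx
    exact (norm_cmat_le _).trans (hK x hx).2

/-- Multiplication by the Hamiltonian density, on `L²`. -/
def hamOp : S.L2 →L[ℂ] S.L2 := multOp (fun x => cmat (S.Ham x)) S.memLp_Ham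

/-- Multiplication by the inverse of the Hamiltonian density, on `L²`. -/
def hamInvOp : S.L2 →L[ℂ] S.L2 := multOp (fun x => cmat (S.Ham x)⁻¹) S.memLp_HamInv

/-! ### The energy space -/

lemma inner_act_symm {x : ℝ} (hx : x ∈ Ioo S.a S.b) (y z : Cd d) :
    inner ℂ (act (cmat (S.Ham x)) y) z = inner ℂ y (act (cmat (S.Ham x)) z) := by
  have h : (cmat (S.Ham x))ᴴ = cmat (S.Ham x) := by
    ext i j
    have := congrFun (congrFun (S.Ham_symm x hx) i) j
    simp only [Matrix.transpose_apply] at this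
    simp [this]
  have h2 : act (cmat (S.Ham x)) = ContinuousLinearMap.adjoint (act (cmat (S.Ham x))) := by
    rw [← ContinuousLinearMap.star_eq_adjoint, ← map_star, Matrix.star_eq_conjTranspose, h]
  conv_lhs => rw [h2]
  exact ContinuousLinearMap.adjoint_inner_left _ _ _

lemma hamOp_symm (u v : S.L2) : inner ℂ (S.hamOp u) v = inner ℂ u (S.hamOp v) := by
  rw [L2.inner_def, L2.inner_def]
  refine integral_congr_ae ?_
  filter_upwards [multOp_coe _ S.memLp_Ham u, multOp_coe _ S.memLp_Ham v, S.ae_mem] with x h1 h2 hx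
  rw [hamOp, h1, h2]
  exact S.inner_act_symm hx _ _

lemma act_lower {c : ℝ} {x : ℝ} (h : ∀ ξ : Fin d → ℝ, c * (ξ ⬝ᵥ ξ) ≤ ξ ⬝ᵥ (S.Ham x *ᵥ ξ))
    (z : Cd d) : c * ‖z‖ ^ 2 ≤ (inner ℂ z (act (cmat (S.Ham x)) z)).re := by
  have h1 := h fun i => (z i).re
  have h2 := h fun i => (z i).im
  have e : (inner ℂ z (act (cmat (S.Ham x)) z)).re
      = (fun i => (z i).re) ⬝ᵥ (S.Ham x *ᵥ fun i => (z i).re)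
        + (fun i => (z i).im) ⬝ᵥ (S.Ham x *ᵥ fun i => (z i).im) := by
    rw [PiLp.inner_apply, Complex.re_sum]
    simp only [dotProduct, ← Finset.sum_add_distrib]
    refine Finset.sum_congr rfl fun i _ => ?_
    have : (act (cmat (S.Ham x)) z) i = ∑ j, (S.Ham x i j : ℂ) * z j := by
      simp [act, Matrix.ofLp_toEuclideanCLM, Matrix.mulVec, dotProduct]
    rw [this]
    simp [Matrix.mulVec, dotProduct]
    ring
  have e2 : ‖z‖ ^ 2 = (fun i => (z i).re) ⬝ᵥ (fun i => (z i).re)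
      + (fun i => (z i).im) ⬝ᵥ (fun i => (z i).im) := by
    rw [EuclideanSpace.norm_sq_eq]
    simp only [dotProduct, ← Finset.sum_add_distrib]
    refine Finset.sum_congr rfl fun i _ => ?_
    rw [← Complex.normSq_eq_norm_sq, Complex.normSq_apply]
  rw [e, e2, mul_add]
  exact add_le_add h1 h2

lemma hamOp_lower : ∃ c : ℝ, 0 < c ∧ ∀ u : S.L2, c * ‖u‖ ^ 2 ≤ (inner ℂ u (S.hamOp u)).re := by
  obtain ⟨c, hc, h⟩ := S.Ham_lower
  refine ⟨c, hc, fun u => ?_⟩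
  have h0 : ‖u‖ ^ 2 = ∫ x, ‖u x‖ ^ 2 ∂S.μ := by
    have := inner_self_eq_norm_sq (𝕜 := ℂ) u
    rw [← this, L2.inner_def]
    have h3 := integral_re (L2.integrable_inner (𝕜 := ℂ) u u)
    rw [← h3]
    refine integral_congr_ae (ae_of_all _ fun x => ?_)
    exact inner_self_eq_norm_sq (𝕜 := ℂ) _
  have h1 : (inner ℂ u (S.hamOp u)).re = ∫ x, (inner ℂ (u x) (S.hamOp u x)).re ∂S.μ := by
    rw [L2.inner_def]
    exact (integral_re (L2.integrable_inner (𝕜 := ℂ) u (S.hamOp u))).symm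
  rw [h0, h1, ← integral_const_mul]
  refine integral_mono_ae ?_ ?_ ?_
  · refine Integrable.const_mul ?_ c
    have := (L2.integrable_inner (𝕜 := ℂ) u u).re
    refine this.congr (ae_of_all _ fun x => ?_)
    exact inner_self_eq_norm_sq (𝕜 := ℂ) _
  · exact (L2.integrable_inner (𝕜 := ℂ) u (S.hamOp u)).re
  · filter_upwards [multOp_coe _ S.memLp_Ham u, S.ae_mem] with x hx hx'
    rw [hamOp, hx]
    exact S.act_lower (h x hx') _

/-- The state space `H`: as a vector space it is `L²((a, b); ℂ^d)`, but it carries the energy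
inner product `⟪u, v⟫ = ∫ ⟪u(x), Ham(x) v(x)⟫ dx`, so that `‖u‖ = ‖Ham^{1/2} u‖_{L²}`. -/
def StateSpace : Type := S.L2

namespace StateSpace

instance : AddCommGroup S.StateSpace := inferInstanceAs (AddCommGroup S.L2)
instance : Module ℂ S.StateSpace := inferInstanceAs (Module ℂ S.L2)

end StateSpace

/-- The identity, from `L²` to the state space. -/
def toState : S.L2 ≃ₗ[ℂ] S.StateSpace := LinearEquiv.refl ℂ S.L2

/-- The energy inner product. -/
abbrev energyCore : InnerProductSpace.Core ℂ S.StateSpace where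
  inner u v := inner ℂ (S.toState.symm u) (S.hamOp (S.toState.symm v))
  conj_inner_symm u v := by
    rw [inner_conj_symm, S.hamOp_symm]
  re_inner_nonneg u := by
    obtain ⟨c, hc, h⟩ := S.hamOp_lower
    exact le_trans (by positivity) (h (S.toState.symm u))
  add_left u v w := by rw [map_add, inner_add_left]
  smul_left u v r := by rw [map_smul, inner_smul_left]
  definite u hu := by
    obtain ⟨c, hc, h⟩ := S.hamOp_lower
    have h1 := h (S.toState.symm u)
    rw [hu, Complex.zero_re] at h1
    have h2 : ‖S.toState.symm u‖ ^ 2 ≤ 0 := by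
      by_contra h3
      nlinarith [mul_pos hc (not_le.1 h3)]
    have h3 : ‖S.toState.symm u‖ = 0 := by
      have := sq_nonneg ‖S.toState.symm u‖
      exact pow_eq_zero_iff (two_ne_zero) |>.1 (le_antisymm h2 this)
    simpa using h3

instance : NormedAddCommGroup S.StateSpace := S.energyCore.toNormedAddCommGroup
instance : InnerProductSpace ℂ S.StateSpace := InnerProductSpace.ofCore S.energyCore.toCore

lemma energy_inner_def (u v : S.StateSpace) :
    inner ℂ u v = inner ℂ (S.toState.symm u) (S.hamOp (S.toState.symm v)) := rfl

lemma isoS_bound (f : S.L2) :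
    ‖S.toState (S.hamInvOp f)‖ ≤ √‖S.hamOp‖ * ‖S.hamInvOp‖ * ‖f‖ := by
  refine le_of_sq_le_sq ?_ (by positivity)
  rw [mul_pow, mul_pow, Real.sq_sqrt (norm_nonneg _)]
  have h1 : ‖S.toState (S.hamInvOp f)‖ ^ 2
      = (inner ℂ (S.hamInvOp f) (S.hamOp (S.hamInvOp f))).re := by
    rw [← inner_self_eq_norm_sq (𝕜 := ℂ), energy_inner_def]
    simp
  rw [h1]
  have h2 := S.hamInvOp.le_opNorm f
  have h3 := S.hamOp.le_opNorm (S.hamInvOp f)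
  calc (inner ℂ (S.hamInvOp f) (S.hamOp (S.hamInvOp f))).re
      ≤ ‖S.hamInvOp f‖ * ‖S.hamOp (S.hamInvOp f)‖ := by
        refine (Complex.re_le_norm _).trans (norm_inner_le_norm _ _)
    _ ≤ ‖S.hamInvOp f‖ * (‖S.hamOp‖ * ‖S.hamInvOp f‖) := by gcongr
    _ = ‖S.hamOp‖ * ‖S.hamInvOp f‖ ^ 2 := by ring
    _ ≤ ‖S.hamOp‖ * (‖S.hamInvOp‖ * ‖f‖) ^ 2 := by gcongr
    _ = _ := by ring

/-- The isomorphism `u ↦ Ham⁻¹ u` from `L²` to the state space, as a bounded operator. -/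
def isoS : S.L2 →L[ℂ] S.StateSpace :=
  (S.toState.toLinearMap ∘ₗ S.hamInvOp.toLinearMap).mkContinuous _ S.isoS_bound

/-! ### The port-Hamiltonian operator -/

/-- `v` is (the continuous representative of) an element of `H¹((a, b); ℂ^d)` and `w ∈ L²` is its
weak derivative: `v` is the indefinite integral of `w`. -/
def IsH1 (v w : ℝ → Cd d) : Prop :=
  MemLp w 2 S.μ ∧ ∀ x ∈ Icc S.a S.b, v x = v S.a + ∫ y in S.a..x, w y

/-- The boundary values `[v(b); v(a)] ∈ ℂ^{2d}`. -/
def bdry (v : ℝ → Cd d) : Fin d ⊕ Fin d → ℂ := Sum.elim (v S.b).ofLp (v S.a).ofLp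

/-- `u` belongs to the domain of the port-Hamiltonian operator and `f` is its image: the function
`v = Ham u` is in `H¹` with derivative `w`, it satisfies the boundary condition
`W [v(b); v(a)] = 0`, and `f = P₁ w + P₀ v`. -/
def IsGraph (u f : S.L2) : Prop :=
  ∃ v w : ℝ → Cd d, S.IsH1 v w ∧ (∀ᵐ x ∂S.μ, v x = act (cmat (S.Ham x)) (u x)) ∧
    cmat S.W *ᵥ S.bdry v = 0 ∧
    ∀ᵐ x ∂S.μ, f x = act (cmat S.P1) (w x) + act (cmat S.P0) (v x)

lemma intervalIntegrable_of_memLp {w : ℝ → Cd d} (hw : MemLp w 2 S.μ) {x : ℝ}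
    (hx : x ∈ Icc S.a S.b) : IntervalIntegrable w volume S.a x := by
  have h1 : Integrable w S.μ := hw.integrable (by norm_num)
  rw [intervalIntegrable_iff_integrableOn_Ioc_of_le hx.1]
  have h2 : IntegrableOn w (Ioc S.a S.b) volume := by
    rw [integrableOn_Ioc_iff_integrableOn_Ioo]
    exact h1
  exact h2.mono_set (Ioc_subset_Ioc_right hx.2)

/-- The graph of the port-Hamiltonian operator. -/
def graph : Submodule ℂ (S.StateSpace × S.StateSpace) where
  carrier := {p | S.IsGraph (S.toState.symm p.1) (S.toState.symm p.2)}
  add_mem' := by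
    rintro ⟨u, f⟩ ⟨u', f'⟩ ⟨v, w, ⟨hw, hv⟩, h1, h2, h3⟩ ⟨v', w', ⟨hw', hv'⟩, h1', h2', h3'⟩
    refine ⟨v + v', w + w', ⟨hw.add hw', fun x hx => ?_⟩, ?_, ?_, ?_⟩
    · simp only [Pi.add_apply]
      rw [intervalIntegral.integral_add (S.intervalIntegrable_of_memLp hw hx)
        (S.intervalIntegrable_of_memLp hw' hx), hv x hx, hv' x hx]
      abel
    · filter_upwards [h1, h1', Lp.coeFn_add (S.toState.symm u) (S.toState.symm u')] with x e1 e2 e3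
      simp only [Prod.mk_add_mk, map_add, Pi.add_apply] at *
      rw [e3, e1, e2, map_add]
    · have : S.bdry (v + v') = S.bdry v + S.bdry v' := by
        funext k
        rcases k with k | k <;> simp [bdry]
      rw [this, Matrix.mulVec_add, h2, h2', add_zero]
    · filter_upwards [h3, h3', Lp.coeFn_add (S.toState.symm f) (S.toState.symm f')] with x e1 e2 e3
      simp only [Prod.mk_add_mk, map_add, Pi.add_apply] at *
      rw [e3, e1, e2]
      abel
  zero_mem' := by
    refine ⟨0, 0, ⟨MemLp.zero, fun x _ => by simp⟩, ?_, ?_, ?_⟩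
    · filter_upwards [Lp.coeFn_zero (Cd d) 2 S.μ] with x e
      simp only [Prod.fst_zero, map_zero, e, Pi.zero_apply]
    · have : S.bdry (0 : ℝ → Cd d) = 0 := by
        funext k
        rcases k with k | k <;> simp [bdry]
      rw [this, Matrix.mulVec_zero]
    · filter_upwards [Lp.coeFn_zero (Cd d) 2 S.μ] with x e
      simp only [Prod.snd_zero, map_zero, e, Pi.zero_apply, add_zero]
  smul_mem' := by
    rintro c ⟨u, f⟩ ⟨v, w, ⟨hw, hv⟩, h1, h2, h3⟩
    refine ⟨c • v, c • w, ⟨hw.const_smul c, fun x hx => ?_⟩, ?_, ?_, ?_⟩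
    · simp only [Pi.smul_apply]
      rw [intervalIntegral.integral_smul, hv x hx, smul_add]
    · filter_upwards [h1, Lp.coeFn_smul c (S.toState.symm u)] with x e1 e2
      simp only [Prod.smul_mk, map_smul, Pi.smul_apply] at *
      rw [e2, e1, map_smul]
    · have : S.bdry (c • v) = c • S.bdry v := by
        funext k
        rcases k with k | k <;> simp [bdry]
      rw [this, Matrix.mulVec_smul, h2, smul_zero]
    · filter_upwards [h3, Lp.coeFn_smul c (S.toState.symm f)] with x e1 e2
      simp only [Prod.smul_mk, map_smul, Pi.smul_apply] at *
      rw [e2, e1, smul_add]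

lemma graph_single_valued (p : S.StateSpace × S.StateSpace) (hp : p ∈ S.graph) (h0 : p.1 = 0) :
    p.2 = 0 := by
  obtain ⟨u, f⟩ := p
  obtain ⟨v, w, ⟨hw, hv⟩, h1, h2, h3⟩ := hp
  simp only at h0 h1 h2 h3 ⊢
  subst h0
  have hwi := S.intervalIntegrable_of_memLp hw (right_mem_Icc.2 S.hab.le)
  have hcont : ContinuousOn v (Icc S.a S.b) := by
    have : ContinuousOn (fun x => v S.a + ∫ y in S.a..x, w y) (Icc S.a S.b) := by
      refine continuousOn_const.add ?_
      have := intervalIntegral.continuousOn_primitive_interval (μ := volume)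
        (hwi.1.congr_set_ae Ioc_ae_eq_Icc.symm |> fun h => by rwa [← uIcc_of_le S.hab.le] at h)
      rwa [uIcc_of_le S.hab.le] at this
    exact this.congr hv
  have hv0 : v =ᵐ[S.μ] 0 := by
    filter_upwards [h1, Lp.coeFn_zero (Cd d) 2 S.μ] with x e1 e2
    rw [e1, map_zero, e2]
    simp
  have hvI : EqOn v 0 (Icc S.a S.b) := by
    refine Measure.eqOn_Icc_of_ae_eq volume S.hab.ne ?_ hcont continuousOn_const
    rwa [Measure.restrict_congr_set Ioo_ae_eq_Icc.symm]
  have hw0 : w =ᵐ[S.μ] 0 := by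
    have h4 := hwi.ae_hasDerivAt_integral
    filter_upwards [ae_restrict_of_ae h4, S.ae_mem] with x hx hxm
    have h5 := hx (by rw [uIcc_of_le S.hab.le]; exact Ioo_subset_Icc_self hxm) S.a left_mem_uIcc
    refine h5.unique ((hasDerivAt_const x (0 : Cd d)).congr_of_eventuallyEq ?_)
    filter_upwards [Icc_mem_nhds hxm.1 hxm.2] with y hy
    have := hv y hy
    rw [hvI hy, hvI (left_mem_Icc.2 S.hab.le)] at this
    simpa using this.symm
  have : S.toState.symm f = 0 := by
    refine Lp.ext ?_
    filter_upwards [h3, hv0, hw0, Lp.coeFn_zero (Cd d) 2 S.μ] with x e1 e2 e3 e4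
    rw [e1, e2, e3, e4]
    simp
  simpa using this

/-- The port-Hamiltonian operator `u ↦ P₁ (Ham u)' + P₀ Ham u`, with domain
`{u | Ham u ∈ H¹, W [(Ham u)(b); (Ham u)(a)] = 0}`, as an unbounded operator in the state space. -/
def op : S.StateSpace →ₗ.[ℂ] S.StateSpace := S.graph.toLinearPMap

lemma op_graph : S.op.graph = S.graph :=
  Submodule.toLinearPMap_graph_eq _ S.graph_single_valued

/-- The operator is accretive. -/
def IsAccretive : Prop := ∀ u : S.op.domain, 0 ≤ (inner ℂ (u : S.StateSpace) (S.op u)).re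

/-! ### The fundamental matrices -/

/-- The coefficient `-P₁⁻¹ (i t Ham(x)⁻¹ + P₀)` of the differential equation. -/
def coeff (t x : ℝ) : Matrix (Fin d) (Fin d) ℂ :=
  -(cmat S.P1⁻¹ * ((Complex.I * t) • cmat (S.Ham x)⁻¹ + cmat S.P0))

/-- `Φ` is the (absolutely continuous) solution on `[a, b]` of
`Φ'(x) = -P₁⁻¹ (i t Ham(x)⁻¹ + P₀) Φ(x)`, `Φ(a) = 1`. -/
def IsFundamental (t : ℝ) (Φ : ℝ → Matrix (Fin d) (Fin d) ℂ) : Prop :=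
  ContinuousOn Φ (Icc S.a S.b) ∧
    ∀ x ∈ Icc S.a S.b, Φ x = 1 + ∫ y in S.a..x, S.coeff t y * Φ y

lemma exists_fundamental (t : ℝ) : ∃ Φ, S.IsFundamental t Φ := by
  obtain ⟨K, hK⟩ := S.exists_inv_bound
  have hcoeff : AEStronglyMeasurable (S.coeff t) (volume.restrict (Ioc S.a S.b)) := by
    have h : (fun x => cmat (S.Ham x)⁻¹)
        = fun x => ∑ i, ∑ j, ((S.Ham x)⁻¹ i j : ℂ) • Matrix.single i j (1 : ℂ) := by
      funext x
      conv_lhs => rw [Matrix.matrix_eq_sum_single (cmat (S.Ham x)⁻¹)]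
      simp [Matrix.smul_single]
    have h1 : StronglyMeasurable fun x => cmat (S.Ham x)⁻¹ := by
      rw [h]
      refine Finset.stronglyMeasurable_fun_sum _ fun i _ =>
        Finset.stronglyMeasurable_fun_sum _ fun j _ => ?_
      exact (Complex.measurable_ofReal.comp
        (measurable_inv_entry S.Ham_meas i j)).stronglyMeasurable.smul_const _
    exact (((h1.const_smul (Complex.I * t)).add_const (cmat S.P0)).const_mul
      (cmat S.P1⁻¹)).neg.aestronglyMeasurable
  have h0 : 0 ≤ K := (norm_nonneg _).trans (hK ((S.a + S.b) / 2)
    ⟨by linarith [S.hab], by linarith [S.hab]⟩).2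
  refine exists_linear_ode (S.coeff t) hcoeff
    (K := ‖cmat S.P1⁻¹‖ * (|t| * K + ‖cmat S.P0‖)) (by positivity) ?_
  rw [← Measure.restrict_congr_set Ioo_ae_eq_Ioc]
  filter_upwards [S.ae_mem] with x hx
  rw [coeff, norm_neg]
  refine (norm_mul_le _ _).trans ?_
  gcongr
  refine (norm_add_le _ _).trans ?_
  gcongr
  rw [norm_smul]
  simp only [norm_mul, Complex.norm_I, one_mul, Complex.norm_real, Real.norm_eq_abs]
  gcongr
  exact (norm_cmat_le _).trans (hK x hx).2

/-- The fundamental matrix `Φ_t` on `[a, b]`. -/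
def fund (t : ℝ) : ℝ → Matrix (Fin d) (Fin d) ℂ := Classical.choose (S.exists_fundamental t)

lemma fund_spec (t : ℝ) : S.IsFundamental t (S.fund t) :=
  Classical.choose_spec (S.exists_fundamental t)

/-- `B_t = ‖Φ_t‖_∞`, the supremum norm over `[a, b]` of the spectral norm. -/
def Bt (t : ℝ) : ℝ := ⨆ x : Icc S.a S.b, ‖S.fund t x‖

/-- The fundamental matrices are bounded uniformly in `t ∈ ℝ`. -/
def ConditionB : Prop := BddAbove (range S.Bt)

/-- `B = sup_t B_t`. -/
def B : ℝ := ⨆ t : ℝ, S.Bt t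

/-- The matrix `T_t = W [Φ_t(b); 1]`. -/
def T (t : ℝ) : Matrix (Fin d) (Fin d) ℂ :=
  cmat S.W * Matrix.fromRows (S.fund t S.b) (1 : Matrix (Fin d) (Fin d) ℂ)

/-! ### The constants -/

/-- The Moore-Penrose inverse `W⁺ = W* (W W*)⁻¹` of the full rank matrix `W`. -/
def Wplus : Matrix (Fin d ⊕ Fin d) (Fin d) ℝ := S.Wᵀ * (S.W * S.Wᵀ)⁻¹

/-- `‖Ham‖_∞`, the `L^∞` norm of the Hamiltonian density on `(a, b)`. -/
def normHam : ℝ := (eLpNorm S.Ham ∞ S.μ).toReal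

/-- The constant in the estimate of `T_t⁻¹` by the resolvent. -/
def constC : ℝ :=
  (1 / (S.b - S.a) ^ (3 / 2 : ℝ) * ‖S.P1‖ ^ 2 * ‖S.P1⁻¹‖ ^ 2 * S.B ^ 3 * (1 + S.B) + 1)
    * ‖S.Wplus‖ * max ((S.b - S.a) ^ (1 / 2 : ℝ) * S.normHam * ‖S.P1‖) 1

/-- The constant in the estimate of the resolvent by `T_t⁻¹`. -/
def constCtilde : ℝ :=
  (S.b - S.a) * S.B ^ 2 * ‖S.isoS‖ ^ 2 * ‖S.P1‖ * ‖S.P1⁻¹‖ ^ 2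
    * max (S.B * ‖S.W‖) ((S.b - S.a) ^ (1 / 2 : ℝ))

end System
end PortHam

end

noncomputable section

namespace PortHam

/-! ### Primitives of integrable functions -/

section Primitive

variable {E : Type*} [NormedAddCommGroup E]

/-! With `v = Ham u`, the resolvent equation `(it + A) u = f` is the linear equation `v' = coeff v +
P₁⁻¹ f` with the boundary condition `Wb v(b) + Wa v(a) = 0`. Since `P₁ coeff = -(it Ham⁻¹ + P₀)` is
skew-adjoint, the form of `P₁` is conserved: `Φ* P₁ Φ = P₁`. Hence `Φ⁻¹ = P₁⁻¹ Φ* P₁` obeys a bound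
as uniform as that of `Φ` (`inner_flow_P1`, `flowInv_flow`, `norm_flowInv_le`).

Variation of constants and the boundary condition give Green's formula (`hamOp_resolvent_eq`): `v(x)
= Φ(x) T⁻¹ (Wa D(a,x) - Wb Φ(b) D(x,b))` with `D(x,y) = ∫ P₁⁻¹ Φ* f` over `(x,y)`. A kernel vector
of `T` would start a homogeneous solution satisfying the boundary condition, that is, an
eigenfunction; so `T` is injective (`T_injective`).

The resolvent is bounded by `T⁻¹` on estimating Green's formula pointwise: `‖v(x)‖` is at most a
constant times `‖T⁻¹‖ ∫ ‖f‖`. Passing between `L¹`, `L²` and `L^∞` costs the factor `b - a`, and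
passing between `L²` and the energy norm costs `‖S‖` on each side.

For the converse, put `L = T⁻¹ Wa` and `R = T⁻¹ Wb Φ(b)`, so that `L + R = 1`. The force `P₁ Φ e`,
cut off to an interval, turns `D` into a length times `e`, so averages of `Φ⁻¹ v` are combinations
of `L e` and `R e`. Suitable intervals bound `L`, `R` and `L - R` by `2N`, with `N` proportional to
the norm of the resolvent (`norm_green_le`). Finally, if `(zb, za) = W⁺ y`, then `T⁻¹ y = R Φ(b)⁻¹
zb + L za` (`norm_T_inv_le`). -/

lemma intervalIntegrable_of_mem_Icc {a b : ℝ} {f : ℝ → E} (hf : IntervalIntegrable f volume a b)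
    {x y : ℝ} (hx : x ∈ Icc a b) (hy : y ∈ Icc a b) : IntervalIntegrable f volume x y := by
  refine hf.mono_set ?_
  rw [uIcc_of_le (hx.1.trans hx.2)]
  exact uIcc_subset_Icc hx hy

/-- A function whose increments are dominated by the integral of an integrable function is
absolutely continuous. -/
lemma absolutelyContinuousOnInterval_of_norm_sub_le {a b : ℝ} (hab : a ≤ b) {h : ℝ → E} {k : ℝ → ℝ}
    (hk : IntervalIntegrable k volume a b)
    (hh : ∀ x ∈ Icc a b, ∀ y ∈ Icc a b, x ≤ y → ‖h y - h x‖ ≤ ∫ s in x..y, k s) :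
    AbsolutelyContinuousOnInterval h a b := by
  have hK := hk.absolutelyContinuousOnInterval_intervalIntegral (c := a) left_mem_uIcc
  have ha := left_mem_Icc.2 hab
  have hle : ∀ x ∈ Icc a b, ∀ y ∈ Icc a b, x ≤ y →
      dist (h x) (h y) ≤ dist (∫ s in a..x, k s) (∫ s in a..y, k s) := by
    intro x hx y hy hxy
    rw [dist_comm, dist_eq_norm, dist_comm (∫ s in a..x, k s), Real.dist_eq,
      intervalIntegral.integral_interval_sub_left (intervalIntegrable_of_mem_Icc hk ha hy)
      (intervalIntegrable_of_mem_Icc hk ha hx)]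
    exact (hh x hx y hy hxy).trans (le_abs_self _)
  -- The variation of `h` over a family of disjoint intervals is at most that of the primitive of
  -- `k`, which is absolutely continuous.
  refine squeeze_zero' (Eventually.of_forall fun _ => Finset.sum_nonneg fun _ _ => dist_nonneg) ?_ hK
  have : ∀ᶠ E : ℕ × (ℕ → ℝ × ℝ) in AbsolutelyContinuousOnInterval.totalLengthFilter ⊓
      𝓟 (AbsolutelyContinuousOnInterval.disjWithin a b),
      E ∈ AbsolutelyContinuousOnInterval.disjWithin a b :=
    eventually_inf_principal.mpr (by simp)
  filter_upwards [this] with I hI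
  refine Finset.sum_le_sum fun i hi => ?_
  obtain ⟨h1, h2⟩ := hI.1 i hi
  rw [uIcc_of_le hab] at h1 h2
  rcases le_total (I.2 i).1 (I.2 i).2 with h3 | h3
  · exact hle _ h1 _ h2 h3
  · rw [dist_comm, dist_comm (∫ s in a..(I.2 i).1, k s)]
    exact hle _ h2 _ h1 h3

variable [NormedSpace ℝ E]

/-- The fundamental theorem of calculus for functions with dominated increments. -/
lemma eq_add_integral_of_ae_hasDerivAt [CompleteSpace E] {a b : ℝ} (hab : a ≤ b) {h g : ℝ → E} {k : ℝ → ℝ}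
    (hk : IntervalIntegrable k volume a b) (hg : IntervalIntegrable g volume a b)
    (hh : ∀ x ∈ Icc a b, ∀ y ∈ Icc a b, x ≤ y → ‖h y - h x‖ ≤ ∫ s in x..y, k s)
    (hd : ∀ᵐ x ∂volume.restrict (Ioo a b), HasDerivAt h (g x) x) :
    ∀ x ∈ Icc a b, h x = h a + ∫ s in a..x, g s := by
  have ha := left_mem_Icc.2 hab
  -- The difference of `h` and the primitive of `g` is absolutely continuous with zero derivative
  -- almost everywhere, hence constant.
  have hac : AbsolutelyContinuousOnInterval (fun x => h x - ∫ s in a..x, g s) a b := by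
    refine absolutelyContinuousOnInterval_of_norm_sub_le hab (hk.add hg.norm) ?_
    intro x hx y hy hxy
    rw [sub_sub_sub_comm, intervalIntegral.integral_interval_sub_left (intervalIntegrable_of_mem_Icc hg ha hy)
      (intervalIntegrable_of_mem_Icc hg ha hx), intervalIntegral.integral_add (intervalIntegrable_of_mem_Icc hk hx hy)
      (intervalIntegrable_of_mem_Icc hg.norm hx hy)]
    exact (norm_sub_le _ _).trans (add_le_add (hh x hx y hy hxy)
      (intervalIntegral.norm_integral_le_integral_norm hxy))
  obtain ⟨C, hC⟩ := hac.const_of_ae_hasDerivAt_zero (by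
    rw [ae_restrict_iff' measurableSet_Ioo] at hd
    have e1 : ∀ᵐ x : ℝ, x ≠ a := by simp [ae_iff, measure_singleton]
    have e2 : ∀ᵐ x : ℝ, x ≠ b := by simp [ae_iff, measure_singleton]
    filter_upwards [hd, hg.ae_hasDerivAt_integral, e1, e2] with x h1 h2 h3 h4 hx
    have h5 := h2 hx a left_mem_uIcc
    rw [uIcc_of_le hab] at hx
    have h6 := (h1 ⟨lt_of_le_of_ne hx.1 h3.symm, lt_of_le_of_ne hx.2 h4⟩).sub h5
    rwa [sub_self] at h6)
  rw [uIcc_of_le hab] at hC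
  intro x hx
  have h1 := hC x hx
  have h2 := hC a ha
  simp only [intervalIntegral.integral_same, sub_zero] at h2
  rw [h2, ← h1]
  abel

lemma continuousOn_of_eq_add_integral {a b : ℝ} (hab : a ≤ b) {v w : ℝ → E}
    (hw : IntervalIntegrable w volume a b)
    (hv : ∀ x ∈ Icc a b, v x = v a + ∫ s in a..x, w s) : ContinuousOn v (Icc a b) := by
  have : ContinuousOn (fun x => v a + ∫ y in a..x, w y) (Icc a b) := by
    refine continuousOn_const.add ?_
    have := intervalIntegral.continuousOn_primitive_interval (μ := volume)
      (hw.1.congr_set_ae Ioc_ae_eq_Icc.symm |> fun h => by rwa [← uIcc_of_le hab] at h)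
    rwa [uIcc_of_le hab] at this
  exact this.congr hv

lemma ae_hasDerivAt_of_eq_add_integral [CompleteSpace E] {a b : ℝ} (hab : a ≤ b) {v w : ℝ → E}
    (hw : IntervalIntegrable w volume a b)
    (hv : ∀ x ∈ Icc a b, v x = v a + ∫ s in a..x, w s) :
    ∀ᵐ x ∂volume.restrict (Ioo a b), HasDerivAt v (w x) x := by
  filter_upwards [ae_restrict_of_ae hw.ae_hasDerivAt_integral, ae_restrict_mem measurableSet_Ioo]
    with x hx hxm
  have h5 := hx (by rw [uIcc_of_le hab]; exact Ioo_subset_Icc_self hxm) a left_mem_uIcc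
  refine (h5.const_add (v a)).congr_of_eventuallyEq ?_
  filter_upwards [Icc_mem_nhds hxm.1 hxm.2] with y hy using hv y hy

end Primitive

/-- The product rule for inner products of primitives. -/
lemma inner_eq_add_integral {E : Type*} [NormedAddCommGroup E] [InnerProductSpace ℂ E]
    [CompleteSpace E] {a b : ℝ} (hab : a ≤ b) {u u' v v' : ℝ → E}
    (hu' : IntervalIntegrable u' volume a b) (hv' : IntervalIntegrable v' volume a b)
    (hu : ∀ x ∈ Icc a b, u x = u a + ∫ s in a..x, u' s)
    (hv : ∀ x ∈ Icc a b, v x = v a + ∫ s in a..x, v' s) :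
    ∀ x ∈ Icc a b, inner ℂ (u x) (v x)
      = inner ℂ (u a) (v a) + ∫ s in a..x, (inner ℂ (u s) (v' s) + inner ℂ (u' s) (v s)) := by
  have ha := left_mem_Icc.2 hab
  have huc := continuousOn_of_eq_add_integral hab hu' hu
  have hvc := continuousOn_of_eq_add_integral hab hv' hv
  obtain ⟨M, hM⟩ := isCompact_Icc.exists_bound_of_continuousOn huc
  obtain ⟨N, hN⟩ := isCompact_Icc.exists_bound_of_continuousOn hvc
  have hM0 : 0 ≤ M := (norm_nonneg _).trans (hM a ha)
  have hN0 : 0 ≤ N := (norm_nonneg _).trans (hN a ha)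
  have hinc : ∀ {f f' : ℝ → E}, IntervalIntegrable f' volume a b →
      (∀ x ∈ Icc a b, f x = f a + ∫ s in a..x, f' s) → ∀ x ∈ Icc a b, ∀ y ∈ Icc a b, x ≤ y →
      ‖f y - f x‖ ≤ ∫ s in x..y, ‖f' s‖ := by
    intro f f' hf' hf x hx y hy hxy
    rw [hf x hx, hf y hy, add_sub_add_left_eq_sub, intervalIntegral.integral_interval_sub_left
      (intervalIntegrable_of_mem_Icc hf' ha hy) (intervalIntegrable_of_mem_Icc hf' ha hx)]
    exact intervalIntegral.norm_integral_le_integral_norm hxy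
  have hI : IntervalIntegrable (fun s => inner ℂ (u s) (v' s) + inner ℂ (u' s) (v s))
      volume a b := by
    have hmeas : ∀ {f : ℝ → E}, ContinuousOn f (Icc a b) →
        AEStronglyMeasurable f (volume.restrict (Ioc a b)) := fun hf =>
      (hf.mono Ioc_subset_Icc_self).aestronglyMeasurable measurableSet_Ioc
    rw [intervalIntegrable_iff_integrableOn_Ioc_of_le hab] at hu' hv' ⊢
    refine Integrable.add ?_ ?_
    · refine (hv'.norm.const_mul M).mono' ((hmeas huc).inner hv'.aestronglyMeasurable) ?_
      filter_upwards [ae_restrict_mem measurableSet_Ioc] with x hx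
      exact (norm_inner_le_norm _ _).trans (by gcongr; exact hM x (Ioc_subset_Icc_self hx))
    · refine (hu'.norm.mul_const N).mono' (hu'.aestronglyMeasurable.inner (hmeas hvc)) ?_
      filter_upwards [ae_restrict_mem measurableSet_Ioc] with x hx
      exact (norm_inner_le_norm _ _).trans (by gcongr; exact hN x (Ioc_subset_Icc_self hx))
  -- The dominating density comes from the suprema `M`, `N` of `‖u‖`, `‖v‖` and from changing one
  -- argument of the inner product at a time.
  refine eq_add_integral_of_ae_hasDerivAt hab (h := fun x => inner ℂ (u x) (v x))
    (k := fun s => M * ‖v' s‖ + N * ‖u' s‖)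
    ((hv'.norm.const_mul M).add (hu'.norm.const_mul N)) hI ?_ ?_
  · intro x hx y hy hxy
    have e : inner ℂ (u y) (v y) - inner ℂ (u x) (v x)
        = inner ℂ (u y) (v y - v x) + inner ℂ (u y - u x) (v x) := by
      rw [inner_sub_right, inner_sub_left]
      ring
    have i1 := (intervalIntegrable_of_mem_Icc hv' hx hy).norm
    have i2 := (intervalIntegrable_of_mem_Icc hu' hx hy).norm
    rw [e, intervalIntegral.integral_add (i1.const_mul M) (i2.const_mul N),
      intervalIntegral.integral_const_mul, intervalIntegral.integral_const_mul]
    refine (norm_add_le _ _).trans (add_le_add ((norm_inner_le_norm _ _).trans ?_)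
      ((norm_inner_le_norm _ _).trans ?_))
    · exact mul_le_mul (hM y hy) (hinc hv' hv x hx y hy hxy) (norm_nonneg _) hM0
    · rw [mul_comm]
      exact mul_le_mul (hN x hx) (hinc hu' hu x hx y hy hxy) (norm_nonneg _) hN0
  · filter_upwards [ae_hasDerivAt_of_eq_add_integral hab hu' hu,
      ae_hasDerivAt_of_eq_add_integral hab hv' hv] with x h1 h2
    exact h1.inner ℂ h2

variable {d : ℕ}

/-! ### Matrices acting on Euclidean spaces -/

lemma norm_cmat_mulVec_le {m n : Type*} [Fintype m] [Fintype n] [DecidableEq n]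
    (A : Matrix m n ℝ) (z : EuclideanSpace ℂ n) :
    ‖WithLp.toLp 2 (cmat A *ᵥ z.ofLp)‖ ≤ ‖A‖ * ‖z‖ := by
  have key : ∀ y : n → ℝ, ∑ i, (A *ᵥ y) i ^ 2 ≤ ‖A‖ ^ 2 * ∑ i, y i ^ 2 := by
    intro y
    have h := Matrix.l2_opNorm_mulVec A (WithLp.toLp 2 y)
    have h2 := pow_le_pow_left₀ (norm_nonneg _) h 2
    rw [mul_pow, EuclideanSpace.norm_sq_eq, EuclideanSpace.norm_sq_eq] at h2
    simpa using h2
  refine le_of_sq_le_sq ?_ (by positivity)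
  rw [mul_pow, EuclideanSpace.norm_sq_eq, EuclideanSpace.norm_sq_eq]
  have h1 : ∀ i, ‖(cmat A *ᵥ z.ofLp) i‖ ^ 2
      = (A *ᵥ fun j => (z j).re) i ^ 2 + (A *ᵥ fun j => (z j).im) i ^ 2 := by
    intro i
    rw [← Complex.normSq_eq_norm_sq, Complex.normSq_apply]
    simp [Matrix.mulVec, dotProduct, sq]
  have h2 : ∀ i, ‖z i‖ ^ 2 = (z i).re ^ 2 + (z i).im ^ 2 := by
    intro i
    rw [← Complex.normSq_eq_norm_sq, Complex.normSq_apply]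
    ring
  simp only [h1, h2, Finset.sum_add_distrib, mul_add]
  exact add_le_add (key _) (key _)

lemma norm_act (A : Matrix (Fin d) (Fin d) ℂ) : ‖act A‖ = ‖A‖ :=
  (Matrix.cstar_norm_def A).symm

lemma act_mul_apply (A B : Matrix (Fin d) (Fin d) ℂ) (z : Cd d) : act (A * B) z = act A (act B z) := by
  simp [act]

lemma act_add_apply (A B : Matrix (Fin d) (Fin d) ℂ) (z : Cd d) :
    act (A + B) z = act A z + act B z := by
  simp [act]

lemma act_smul_apply (c : ℂ) (A : Matrix (Fin d) (Fin d) ℂ) (z : Cd d) :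
    act (c • A) z = c • act A z := by
  simp [act]

lemma act_neg_apply (A : Matrix (Fin d) (Fin d) ℂ) (z : Cd d) : act (-A) z = -act A z := by
  simp [act]

lemma act_one_apply (z : Cd d) : act (1 : Matrix (Fin d) (Fin d) ℂ) z = z := by
  simp [act]

lemma inner_act_left (A : Matrix (Fin d) (Fin d) ℂ) (y z : Cd d) :
    inner ℂ (act A y) z = inner ℂ y (act Aᴴ z) := by
  have : act Aᴴ = ContinuousLinearMap.adjoint (act A) := by
    rw [← ContinuousLinearMap.star_eq_adjoint, ← map_star, Matrix.star_eq_conjTranspose]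
  rw [this, ContinuousLinearMap.adjoint_inner_right]

lemma cmat_conjTranspose {m n : Type*} (A : Matrix m n ℝ) : (cmat A)ᴴ = cmat Aᵀ := by
  ext i j
  simp

lemma cmat_mul {l m n : Type*} [Fintype m] (A : Matrix l m ℝ) (B : Matrix m n ℝ) :
    cmat (A * B) = cmat A * cmat B :=
  Matrix.map_mul (f := Complex.ofRealHom)

lemma cmat_one {n : Type*} [DecidableEq n] : cmat (1 : Matrix n n ℝ) = 1 :=
  Matrix.map_one _ Complex.ofReal_zero Complex.ofReal_one

/-! ### The coefficient matrix and its skewness for the form of `P₁`. -/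

namespace System

variable (S : System d)

lemma P1_mul_inv : cmat S.P1 * cmat S.P1⁻¹ = 1 := by
  rw [← cmat_mul, Matrix.mul_nonsing_inv _ ((Matrix.isUnit_iff_isUnit_det _).1 S.P1_inv), cmat_one]

lemma P1_inv_mul : cmat S.P1⁻¹ * cmat S.P1 = 1 := by
  rw [← cmat_mul, Matrix.nonsing_inv_mul _ ((Matrix.isUnit_iff_isUnit_det _).1 S.P1_inv), cmat_one]

lemma act_P1_act_inv (z : Cd d) : act (cmat S.P1) (act (cmat S.P1⁻¹) z) = z := by
  rw [← act_mul_apply, S.P1_mul_inv, act_one_apply]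

lemma act_inv_act_P1 (z : Cd d) : act (cmat S.P1⁻¹) (act (cmat S.P1) z) = z := by
  rw [← act_mul_apply, S.P1_inv_mul, act_one_apply]

lemma act_P1_act_coeff (t x : ℝ) (z : Cd d) : act (cmat S.P1) (act (S.coeff t x) z)
    = -((Complex.I * t) • act (cmat (S.Ham x)⁻¹) z + act (cmat S.P0) z) := by
  rw [coeff, act_neg_apply, map_neg, act_mul_apply, S.act_P1_act_inv, act_add_apply, act_smul_apply]

lemma act_coeff (t x : ℝ) (z : Cd d) : act (S.coeff t x) z = -act (cmat S.P1⁻¹)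
    ((Complex.I * t) • act (cmat (S.Ham x)⁻¹) z + act (cmat S.P0) z) := by
  rw [coeff, act_neg_apply, act_mul_apply, act_add_apply, act_smul_apply]

/-- The coefficient matrix is skew-adjoint for the sesquilinear form given by `P₁`. -/
lemma inner_coeff {t x : ℝ} (hx : x ∈ Ioo S.a S.b) (y z : Cd d) :
    inner ℂ y (act (cmat S.P1) (act (S.coeff t x) z))
      + inner ℂ (act (S.coeff t x) y) (act (cmat S.P1) z) = 0 := by
  have h1 : inner ℂ (act (S.coeff t x) y) (act (cmat S.P1) z)
      = inner ℂ (act (cmat S.P1) (act (S.coeff t x) y)) z := by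
    rw [inner_act_left (cmat S.P1), cmat_conjTranspose, S.P1_symm]
  have hH : ((S.Ham x)⁻¹)ᵀ = (S.Ham x)⁻¹ := by
    rw [Matrix.transpose_nonsing_inv, S.Ham_symm x hx]
  have h0 : cmat (-S.P0) = -cmat S.P0 := by
    ext i j
    simp
  -- `it Ham⁻¹` is skew-adjoint because `Ham⁻¹` is real symmetric and `t` is real; `P₀` is real and
  -- skew-symmetric.
  rw [h1, act_P1_act_coeff, act_P1_act_coeff, inner_neg_right, inner_neg_left, inner_add_right,
    inner_add_left, inner_smul_left, inner_smul_right, inner_act_left (cmat (S.Ham x)⁻¹),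
    cmat_conjTranspose, hH, inner_act_left (cmat S.P0), cmat_conjTranspose, S.P0_skew, h0,
    act_neg_apply, inner_neg_right]
  simp only [map_mul, Complex.conj_I, Complex.conj_ofReal]
  ring

lemma stronglyMeasurable_coeff (t : ℝ) : StronglyMeasurable (S.coeff t) := by
  have h : (fun x => cmat (S.Ham x)⁻¹)
      = fun x => ∑ i, ∑ j, ((S.Ham x)⁻¹ i j : ℂ) • Matrix.single i j (1 : ℂ) := by
    funext x
    conv_lhs => rw [Matrix.matrix_eq_sum_single (cmat (S.Ham x)⁻¹)]
    simp [Matrix.smul_single]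
  have h1 : StronglyMeasurable fun x => cmat (S.Ham x)⁻¹ := by
    rw [h]
    refine Finset.stronglyMeasurable_fun_sum _ fun i _ =>
      Finset.stronglyMeasurable_fun_sum _ fun j _ => ?_
    exact (Complex.measurable_ofReal.comp
      (measurable_inv_entry S.Ham_meas i j)).stronglyMeasurable.smul_const _
  exact (((h1.const_smul (Complex.I * t)).add_const (cmat S.P0)).const_mul (cmat S.P1⁻¹)).neg

lemma exists_norm_coeff_le (t : ℝ) : ∃ K : ℝ, ∀ x ∈ Ioo S.a S.b, ‖S.coeff t x‖ ≤ K := by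
  obtain ⟨K, hK⟩ := S.exists_inv_bound
  refine ⟨‖cmat S.P1⁻¹‖ * (|t| * K + ‖cmat S.P0‖), fun x hx => ?_⟩
  rw [coeff, norm_neg]
  refine (norm_mul_le _ _).trans ?_
  gcongr
  refine (norm_add_le _ _).trans ?_
  gcongr
  rw [norm_smul]
  simp only [norm_mul, Complex.norm_I, one_mul, Complex.norm_real, Real.norm_eq_abs]
  gcongr
  exact (norm_cmat_le _).trans (hK x hx).2

/-! ### The flow of the homogeneous equation -/

/-- The fundamental matrix as an operator on `ℂ^d`. -/
abbrev flow (t x : ℝ) : Cd d →L[ℂ] Cd d := act (S.fund t x)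

lemma intervalIntegrable_coeff_mul_fund (t : ℝ) :
    IntervalIntegrable (fun y => S.coeff t y * S.fund t y) volume S.a S.b := by
  obtain ⟨K, hK⟩ := S.exists_norm_coeff_le t
  have hc := (S.fund_spec t).1
  obtain ⟨M, hM⟩ := isCompact_Icc.exists_bound_of_continuousOn hc
  rw [intervalIntegrable_iff_integrableOn_Ioc_of_le S.hab.le, integrableOn_Ioc_iff_integrableOn_Ioo]
  refine Integrable.of_bound (C := K * M) ?_ ?_
  · exact (S.stronglyMeasurable_coeff t).aestronglyMeasurable.mul
      ((hc.mono Ioo_subset_Icc_self).aestronglyMeasurable measurableSet_Ioo)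
  · filter_upwards [S.ae_mem] with x hx
    refine (norm_mul_le _ _).trans ?_
    exact mul_le_mul (hK x hx) (hM x (Ioo_subset_Icc_self hx)) (norm_nonneg _)
      ((norm_nonneg _).trans (hK x hx))

/-- Evaluation of the action of a matrix at a vector. -/
def actAt (c : Cd d) : Matrix (Fin d) (Fin d) ℂ →L[ℂ] Cd d :=
  LinearMap.mkContinuous
    { toFun := fun A => act A c
      map_add' := fun A B => act_add_apply A B c
      map_smul' := fun r A => act_smul_apply r A c } ‖c‖
    fun A => by
      rw [← norm_act, mul_comm]
      exact (act A).le_opNorm c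

lemma actAt_apply (c : Cd d) (A : Matrix (Fin d) (Fin d) ℂ) : actAt c A = act A c := rfl

lemma intervalIntegrable_coeff_flow (t : ℝ) (c : Cd d) :
    IntervalIntegrable (fun y => act (S.coeff t y) (S.flow t y c)) volume S.a S.b := by
  have h := S.intervalIntegrable_coeff_mul_fund t
  rw [intervalIntegrable_iff_integrableOn_Ioc_of_le S.hab.le] at h ⊢
  refine ((actAt c).integrable_comp h).congr (ae_of_all _ fun y => ?_)
  exact act_mul_apply _ _ _

lemma flow_left (t : ℝ) (c : Cd d) : S.flow t S.a c = c := by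
  rw [flow, (S.fund_spec t).2 S.a (left_mem_Icc.2 S.hab.le)]
  simp

lemma flow_eq_add_integral (t : ℝ) (c : Cd d) : ∀ x ∈ Icc S.a S.b,
    S.flow t x c = S.flow t S.a c + ∫ y in S.a..x, act (S.coeff t y) (S.flow t y c) := by
  intro x hx
  rw [S.flow_left t c]
  have h := intervalIntegrable_of_mem_Icc (S.intervalIntegrable_coeff_mul_fund t)
    (left_mem_Icc.2 S.hab.le) hx
  have h1 := (actAt c).intervalIntegral_comp_comm h
  have h2 := congrArg (actAt c) ((S.fund_spec t).2 x hx)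
  rw [map_add, ← h1] at h2
  simp only [actAt_apply, act_one_apply, act_mul_apply] at h2
  exact h2

lemma continuousOn_flow_apply (t : ℝ) (c : Cd d) :
    ContinuousOn (fun x => S.flow t x c) (Icc S.a S.b) :=
  continuousOn_of_eq_add_integral S.hab.le (S.intervalIntegrable_coeff_flow t c)
    (S.flow_eq_add_integral t c)

lemma Bt_nonneg (t : ℝ) : 0 ≤ S.Bt t := Real.iSup_nonneg fun _ => norm_nonneg _

lemma B_nonneg : 0 ≤ S.B := Real.iSup_nonneg S.Bt_nonneg

lemma norm_flow_le (hB : S.ConditionB) (t : ℝ) {x : ℝ} (hx : x ∈ Icc S.a S.b) :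
    ‖S.flow t x‖ ≤ S.B := by
  obtain ⟨M, hM⟩ := isCompact_Icc.exists_bound_of_continuousOn (S.fund_spec t).1
  rw [norm_act]
  refine le_trans ?_ (le_ciSup hB t)
  exact le_ciSup (f := fun x : Icc S.a S.b => ‖S.fund t x‖)
    ⟨M, by rintro _ ⟨y, rfl⟩; exact hM y y.2⟩ ⟨x, hx⟩

/-- The conservation law of the inhomogeneous equation `v' = coeff v + P₁⁻¹ f`. -/
lemma inner_flow_P1 {t : ℝ} {v w f : ℝ → Cd d} (hw : IntervalIntegrable w volume S.a S.b)
    (hv : ∀ x ∈ Icc S.a S.b, v x = v S.a + ∫ y in S.a..x, w y)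
    (hwf : ∀ᵐ x ∂S.μ, w x = act (S.coeff t x) (v x) + act (cmat S.P1⁻¹) (f x)) (c : Cd d) :
    ∀ x ∈ Icc S.a S.b, inner ℂ (S.flow t x c) (act (cmat S.P1) (v x))
      = inner ℂ c (act (cmat S.P1) (v S.a)) + ∫ y in S.a..x, inner ℂ (S.flow t y c) (f y) := by
  intro x hx
  have ha := left_mem_Icc.2 S.hab.le
  have hpw : IntervalIntegrable (fun y => act (cmat S.P1) (w y)) volume S.a S.b := by
    rw [intervalIntegrable_iff_integrableOn_Ioc_of_le S.hab.le] at hw ⊢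
    exact (act (cmat S.P1)).integrable_comp hw
  have hpv : ∀ x ∈ Icc S.a S.b, act (cmat S.P1) (v x)
      = act (cmat S.P1) (v S.a) + ∫ y in S.a..x, act (cmat S.P1) (w y) := by
    intro x hx
    rw [(act (cmat S.P1)).intervalIntegral_comp_comm (intervalIntegrable_of_mem_Icc hw ha hx),
      ← map_add, ← hv x hx]
  -- Product rule for `Φ c` and `P₁ v`; by skewness the coefficient terms cancel below, and only the
  -- force survives.
  rw [inner_eq_add_integral S.hab.le (S.intervalIntegrable_coeff_flow t c) hpw
    (S.flow_eq_add_integral t c) hpv x hx, S.flow_left]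
  congr 1
  refine intervalIntegral.integral_congr_ae_restrict ?_
  rw [uIoc_of_le hx.1, ← Measure.restrict_congr_set Ioo_ae_eq_Ioc]
  have hsub : Ioo S.a x ⊆ Ioo S.a S.b := Ioo_subset_Ioo_right hx.2
  filter_upwards [ae_restrict_of_ae_restrict_of_subset hsub hwf,
    ae_restrict_mem measurableSet_Ioo] with y h1 h2
  rw [h1, map_add, S.act_P1_act_inv, inner_add_right, add_right_comm,
    S.inner_coeff (hsub h2), zero_add]

/-- The inverse `P₁⁻¹ Φ_t* P₁` of the fundamental matrix. -/
def flowInv (t x : ℝ) : Cd d →L[ℂ] Cd d :=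
  act (cmat S.P1⁻¹ * (S.fund t x)ᴴ * cmat S.P1)

/-- Without force, the conservation law reads `Φ* P₁ Φ = P₁`. -/
lemma flowInv_flow (t : ℝ) {x : ℝ} (hx : x ∈ Icc S.a S.b) (c : Cd d) :
    S.flowInv t x (S.flow t x c) = c := by
  have h : act (S.fund t x)ᴴ (act (cmat S.P1) (S.flow t x c)) = act (cmat S.P1) c := by
    refine ext_inner_left ℂ fun e => ?_
    rw [← inner_act_left]
    have := S.inner_flow_P1 (t := t) (f := 0) (S.intervalIntegrable_coeff_flow t c)
      (S.flow_eq_add_integral t c) (ae_of_all _ fun y => by simp) e x hx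
    simpa [S.flow_left] using this
  rw [flowInv, act_mul_apply, act_mul_apply, h, S.act_inv_act_P1]

/-- In finite dimension a left inverse is also a right inverse. -/
lemma flow_flowInv (t : ℝ) {x : ℝ} (hx : x ∈ Icc S.a S.b) (c : Cd d) :
    S.flow t x (S.flowInv t x c) = c := by
  have h : (S.flowInv t x).toLinearMap * (S.flow t x).toLinearMap = 1 :=
    LinearMap.ext fun c => S.flowInv_flow t hx c
  exact LinearMap.congr_fun (mul_eq_one_comm.1 h) c

lemma norm_flowInv_le (hB : S.ConditionB) (t : ℝ) {x : ℝ} (hx : x ∈ Icc S.a S.b) :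
    ‖S.flowInv t x‖ ≤ ‖S.P1⁻¹‖ * S.B * ‖S.P1‖ := by
  rw [flowInv, norm_act]
  have h0 := S.B_nonneg
  have h1 : ‖(S.fund t x)ᴴ‖ ≤ S.B := by
    rw [Matrix.l2_opNorm_conjTranspose, ← norm_act]
    exact S.norm_flow_le hB t hx
  refine (norm_mul_le _ _).trans ?_
  gcongr
  · refine (norm_mul_le _ _).trans ?_
    gcongr
    exact norm_cmat_le _
  · exact norm_cmat_le _

/-- The Duhamel term `P₁⁻¹ ∫ Φ_t* f`. -/
def duhamel (t : ℝ) (f : ℝ → Cd d) (x y : ℝ) : Cd d :=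
  ∫ s in x..y, act (cmat S.P1⁻¹) (act (S.fund t s)ᴴ (f s))

lemma norm_duhamel_integrand_le (hB : S.ConditionB) (t : ℝ) (f : ℝ → Cd d) {s : ℝ}
    (hs : s ∈ Icc S.a S.b) :
    ‖act (cmat S.P1⁻¹) (act (S.fund t s)ᴴ (f s))‖ ≤ ‖S.P1⁻¹‖ * S.B * ‖f s‖ := by
  have h0 := S.B_nonneg
  have h1 : ‖act (S.fund t s)ᴴ‖ ≤ S.B := by
    rw [norm_act, Matrix.l2_opNorm_conjTranspose, ← norm_act]
    exact S.norm_flow_le hB t hs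
  have h2 : ‖act (cmat S.P1⁻¹)‖ ≤ ‖S.P1⁻¹‖ := by
    rw [norm_act]
    exact norm_cmat_le _
  refine (ContinuousLinearMap.le_of_opNorm_le _ h2 _).trans ?_
  rw [mul_assoc]
  gcongr
  exact ContinuousLinearMap.le_of_opNorm_le _ h1 _

lemma intervalIntegrable_fund_conjTranspose (t : ℝ) {f : ℝ → Cd d}
    (hf : IntervalIntegrable f volume S.a S.b) :
    IntervalIntegrable (fun s => act (S.fund t s)ᴴ (f s)) volume S.a S.b := by
  obtain ⟨M, hM⟩ := isCompact_Icc.exists_bound_of_continuousOn (S.fund_spec t).1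
  rw [intervalIntegrable_iff_integrableOn_Ioc_of_le S.hab.le] at hf ⊢
  refine (hf.norm.const_mul M).mono' ?_ ?_
  · have h1 : ContinuousOn (fun s => (S.fund t s)ᴴ) (Icc S.a S.b) :=
      continuous_star.comp_continuousOn (S.fund_spec t).1
    have h2 : Continuous (act (d := d)) := by
      have : Isometry (act (d := d)) := AddMonoidHomClass.isometry_of_norm _ norm_act
      exact this.continuous
    exact (ContinuousLinearMap.id ℂ (Cd d →L[ℂ] Cd d)).aestronglyMeasurable_comp₂
      (((h2.comp_continuousOn h1).mono Ioc_subset_Icc_self).aestronglyMeasurable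
        measurableSet_Ioc) hf.aestronglyMeasurable
  · filter_upwards [ae_restrict_mem measurableSet_Ioc] with s hs
    refine ContinuousLinearMap.le_of_opNorm_le _ ?_ _
    rw [norm_act, Matrix.l2_opNorm_conjTranspose]
    exact hM s (Ioc_subset_Icc_self hs)

lemma intervalIntegrable_duhamel (t : ℝ) {f : ℝ → Cd d}
    (hf : IntervalIntegrable f volume S.a S.b) :
    IntervalIntegrable (fun s => act (cmat S.P1⁻¹) (act (S.fund t s)ᴴ (f s))) volume S.a S.b := by
  have := S.intervalIntegrable_fund_conjTranspose t hf
  rw [intervalIntegrable_iff_integrableOn_Ioc_of_le S.hab.le] at this ⊢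
  exact (act (cmat S.P1⁻¹)).integrable_comp this

/-- Variation of constants. -/
lemma eq_flow_add_duhamel {t : ℝ} {v w f : ℝ → Cd d} (hw : IntervalIntegrable w volume S.a S.b)
    (hf : IntervalIntegrable f volume S.a S.b)
    (hv : ∀ x ∈ Icc S.a S.b, v x = v S.a + ∫ y in S.a..x, w y)
    (hwf : ∀ᵐ x ∂S.μ, w x = act (S.coeff t x) (v x) + act (cmat S.P1⁻¹) (f x)) :
    ∀ x ∈ Icc S.a S.b, v x = S.flow t x (v S.a + S.duhamel t f S.a x) := by
  intro x hx
  have ha := left_mem_Icc.2 S.hab.le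
  have hi := intervalIntegrable_of_mem_Icc (S.intervalIntegrable_fund_conjTranspose t hf) ha hx
  -- The conservation law against every `e` integrates `(Φ* P₁ v)' = Φ* f`. Applying `P₁⁻¹` then
  -- gives `Φ⁻¹ v`, because `P₁⁻¹ Φ* P₁ = Φ⁻¹`.
  have h : act (S.fund t x)ᴴ (act (cmat S.P1) (v x)) = act (cmat S.P1) (v S.a)
      + ∫ y in S.a..x, act (S.fund t y)ᴴ (f y) := by
    refine ext_inner_left ℂ fun e => ?_
    have h1 := ((innerSL ℂ e).intervalIntegral_comp_comm hi)
    simp only [innerSL_apply_apply] at h1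
    rw [← inner_act_left, S.inner_flow_P1 hw hv hwf e x hx, inner_add_right, ← h1]
    simp only [inner_act_left]
  have h2 : S.flowInv t x (v x) = v S.a + S.duhamel t f S.a x := by
    rw [flowInv, act_mul_apply, act_mul_apply, h, map_add, S.act_inv_act_P1, duhamel,
      (act (cmat S.P1⁻¹)).intervalIntegral_comp_comm hi]
  rw [← h2, S.flow_flowInv t hx]

end System

/-- A resolvent of `A` at `-z` gives a resolvent of `-A` at `z`. -/
lemma IsResolvent.neg {H : Type*} [NormedAddCommGroup H] [InnerProductSpace ℂ H] {A : H →ₗ.[ℂ] H}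
    {z : ℂ} {R : H →L[ℂ] H} (h : IsResolvent A (-z) R) : IsResolvent (-A) z (-R) := by
  refine ⟨fun u => ?_, fun f => ?_⟩
  · have := h.1 u
    rw [LinearPMap.neg_apply, _root_.neg_apply, ← map_neg, ← this]
    congr 1
    rw [this, neg_smul]
    abel
  · obtain ⟨u, h1, h2⟩ := h.2 (-f)
    refine ⟨u, by rw [h1, map_neg]; rfl, ?_⟩
    rw [LinearPMap.neg_apply, ← neg_eq_iff_eq_neg.2 h2, neg_smul]
    abel

namespace System

variable (S : System d)

/-! ### The boundary matrix -/

/-- The block of the boundary matrix that acts on the value at `b`. -/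
def Wb : Matrix (Fin d) (Fin d) ℂ := (cmat S.W).toCols₁

/-- The block of the boundary matrix that acts on the value at `a`. -/
def Wa : Matrix (Fin d) (Fin d) ℂ := (cmat S.W).toCols₂

lemma cmat_W_mulVec_sumElim (y z : Cd d) :
    cmat S.W *ᵥ Sum.elim y.ofLp z.ofLp = (act S.Wb y + act S.Wa z).ofLp := by
  conv_lhs => rw [← Matrix.fromCols_toCols (cmat S.W)]
  rw [Matrix.fromCols_mulVec_sumElim]
  simp [act, Matrix.ofLp_toEuclideanCLM, Wb, Wa]

lemma norm_toLp_sumElim_sq (y z : Cd d) :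
    ‖WithLp.toLp 2 (Sum.elim y.ofLp z.ofLp)‖ ^ 2 = ‖y‖ ^ 2 + ‖z‖ ^ 2 := by
  rw [EuclideanSpace.norm_sq_eq, EuclideanSpace.norm_sq_eq, EuclideanSpace.norm_sq_eq]
  simp

lemma norm_act_Wb_le (y : Cd d) : ‖act S.Wb y‖ ≤ ‖S.W‖ * ‖y‖ := by
  have h := norm_cmat_mulVec_le S.W (WithLp.toLp 2 (Sum.elim y.ofLp (0 : Cd d).ofLp))
  have h1 : ‖WithLp.toLp 2 (Sum.elim y.ofLp (0 : Cd d).ofLp)‖ = ‖y‖ := by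
    rw [← sq_eq_sq₀ (norm_nonneg _) (norm_nonneg _), norm_toLp_sumElim_sq]
    simp
  rw [h1, cmat_W_mulVec_sumElim, map_zero, add_zero] at h
  exact h

lemma norm_act_Wa_le (y : Cd d) : ‖act S.Wa y‖ ≤ ‖S.W‖ * ‖y‖ := by
  have h := norm_cmat_mulVec_le S.W (WithLp.toLp 2 (Sum.elim (0 : Cd d).ofLp y.ofLp))
  have h1 : ‖WithLp.toLp 2 (Sum.elim (0 : Cd d).ofLp y.ofLp)‖ = ‖y‖ := by
    rw [← sq_eq_sq₀ (norm_nonneg _) (norm_nonneg _), norm_toLp_sumElim_sq]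
    simp
  rw [h1, cmat_W_mulVec_sumElim, map_zero, zero_add] at h
  exact h

lemma bdry_condition_iff (v : ℝ → Cd d) :
    cmat S.W *ᵥ S.bdry v = 0 ↔ act S.Wb (v S.b) + act S.Wa (v S.a) = 0 := by
  rw [bdry, cmat_W_mulVec_sumElim]
  exact WithLp.ofLp_eq_zero 2

lemma T_eq (t : ℝ) : S.T t = S.Wb * S.fund t S.b + S.Wa := by
  rw [T]
  conv_lhs => rw [← Matrix.fromCols_toCols (cmat S.W)]
  rw [Matrix.fromCols_mul_fromRows, mul_one]
  rfl

lemma act_T (t : ℝ) (c : Cd d) :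
    act (S.T t) c = act S.Wb (S.flow t S.b c) + act S.Wa c := by
  rw [T_eq, act_add_apply, act_mul_apply]

/-- `W Wᵀ` has the same rank `d` as `W`, so it is invertible. -/
lemma W_mul_Wplus : S.W * S.Wplus = 1 := by
  have h : IsUnit (S.W * S.Wᵀ) := by
    rw [← Matrix.mulVec_surjective_iff_isUnit]
    have h1 : (S.W * S.Wᵀ).rank = d := by rw [Matrix.rank_self_mul_transpose, S.W_rank]
    have h2 : LinearMap.range (S.W * S.Wᵀ).mulVecLin = ⊤ := by
      refine Submodule.eq_top_of_finrank_eq ?_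
      rw [← Matrix.rank, h1]
      simp
    exact LinearMap.range_eq_top.1 h2
  rw [Wplus, ← Matrix.mul_assoc, Matrix.mul_nonsing_inv _ ((Matrix.isUnit_iff_isUnit_det _).1 h)]

/-- Every vector is a boundary combination of vectors whose size is controlled by `W⁺`. -/
lemma exists_boundary_values (y : Cd d) : ∃ zb za : Cd d, act S.Wb zb + act S.Wa za = y ∧
    ‖zb‖ ≤ ‖S.Wplus‖ * ‖y‖ ∧ ‖za‖ ≤ ‖S.Wplus‖ * ‖y‖ := by
  -- The witnesses are the two halves of `W⁺ y`, each no longer than the whole vector.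
  set z : Fin d ⊕ Fin d → ℂ := cmat S.Wplus *ᵥ y.ofLp with hz
  have h := norm_cmat_mulVec_le S.Wplus y
  have hsplit : z = Sum.elim (WithLp.toLp 2 (z ∘ Sum.inl) : Cd d).ofLp
      (WithLp.toLp 2 (z ∘ Sum.inr) : Cd d).ofLp := by
    simp [Sum.elim_comp_inl_inr]
  have hn : ‖WithLp.toLp 2 z‖ ^ 2 = ‖(WithLp.toLp 2 (z ∘ Sum.inl) : Cd d)‖ ^ 2
      + ‖(WithLp.toLp 2 (z ∘ Sum.inr) : Cd d)‖ ^ 2 := by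
    rw [← norm_toLp_sumElim_sq, ← hsplit]
  refine ⟨WithLp.toLp 2 (z ∘ Sum.inl), WithLp.toLp 2 (z ∘ Sum.inr), ?_, ?_, ?_⟩
  · refine WithLp.ofLp_injective 2 ?_
    rw [← cmat_W_mulVec_sumElim, ← hsplit, hz, Matrix.mulVec_mulVec, ← cmat_mul, S.W_mul_Wplus,
      cmat_one, Matrix.one_mulVec]
  · refine le_trans (le_of_sq_le_sq ?_ (norm_nonneg _)) h
    rw [hn]
    exact le_add_of_nonneg_right (sq_nonneg _)
  · refine le_trans (le_of_sq_le_sq ?_ (norm_nonneg _)) h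
    rw [hn]
    exact le_add_of_nonneg_left (sq_nonneg _)

/-! ### Norms on the energy space -/

lemma hamOp_hamInvOp (f : S.L2) : S.hamOp (S.hamInvOp f) = f := by
  obtain ⟨K, hK⟩ := S.exists_inv_bound
  refine Lp.ext ?_
  filter_upwards [multOp_coe _ S.memLp_Ham (S.hamInvOp f), multOp_coe _ S.memLp_HamInv f, S.ae_mem]
    with x h1 h2 hx
  rw [hamOp, h1, hamInvOp, h2, ← act_mul_apply, ← cmat_mul,
    Matrix.mul_nonsing_inv _ ((Matrix.isUnit_iff_isUnit_det _).1 (hK x hx).1), cmat_one,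
    act_one_apply]

lemma hamInvOp_hamOp (f : S.L2) : S.hamInvOp (S.hamOp f) = f := by
  obtain ⟨K, hK⟩ := S.exists_inv_bound
  refine Lp.ext ?_
  filter_upwards [multOp_coe _ S.memLp_HamInv (S.hamOp f), multOp_coe _ S.memLp_Ham f, S.ae_mem]
    with x h1 h2 hx
  rw [hamInvOp, h1, hamOp, h2, ← act_mul_apply, ← cmat_mul,
    Matrix.nonsing_inv_mul _ ((Matrix.isUnit_iff_isUnit_det _).1 (hK x hx).1), cmat_one,
    act_one_apply]

lemma isoS_apply (f : S.L2) : S.isoS f = S.toState (S.hamInvOp f) := rfl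

/-- The adjoint of `isoS` is the identity, hence this bound of the `L²` norm. -/
lemma norm_le_isoS (f : S.L2) : ‖f‖ ≤ ‖S.isoS‖ * ‖S.toState f‖ := by
  have h1 : ‖f‖ ^ 2 = RCLike.re (inner ℂ (S.isoS f) (S.toState f)) := by
    rw [energy_inner_def, isoS_apply, LinearEquiv.symm_apply_apply, LinearEquiv.symm_apply_apply,
      ← hamOp_symm, hamOp_hamInvOp, inner_self_eq_norm_sq]
  have h2 : ‖f‖ * ‖f‖ ≤ ‖f‖ * (‖S.isoS‖ * ‖S.toState f‖) := by
    calc ‖f‖ * ‖f‖ = RCLike.re (inner ℂ (S.isoS f) (S.toState f)) := by rw [← h1, sq]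
      _ ≤ ‖S.isoS f‖ * ‖S.toState f‖ := (RCLike.re_le_norm _).trans (norm_inner_le_norm _ _)
      _ ≤ ‖S.isoS‖ * ‖f‖ * ‖S.toState f‖ := by gcongr; exact S.isoS.le_opNorm f
      _ = ‖f‖ * (‖S.isoS‖ * ‖S.toState f‖) := by ring
  rcases (norm_nonneg f).eq_or_lt with h0 | h0
  · rw [← h0]
    positivity
  · exact le_of_mul_le_mul_left h2 h0

lemma normHam_nonneg : 0 ≤ S.normHam := ENNReal.toReal_nonneg

lemma ae_norm_Ham_le : ∀ᵐ x ∂S.μ, ‖S.Ham x‖ ≤ S.normHam := by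
  obtain ⟨K, hK⟩ := S.Ham_upper
  have hfin : eLpNorm S.Ham ∞ S.μ ≠ ∞ := by
    rw [eLpNorm_exponent_top]
    refine ((eLpNormEssSup_lt_top_of_ae_bound (C := K) ?_)).ne
    filter_upwards [S.ae_mem] with x hx using hK x hx
  filter_upwards [ae_le_eLpNormEssSup (f := S.Ham) (μ := S.μ)] with x hx
  rw [← eLpNorm_exponent_top] at hx
  have := ENNReal.toReal_mono hfin hx
  rwa [toReal_enorm] at this

lemma norm_hamOp_le (f : S.L2) : ‖S.hamOp f‖ ≤ S.normHam * ‖f‖ := by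
  refine Lp.norm_le_mul_norm_of_ae_le_mul ?_
  filter_upwards [multOp_coe _ S.memLp_Ham f, S.ae_norm_Ham_le] with x h1 h2
  rw [hamOp, h1]
  refine ContinuousLinearMap.le_of_opNorm_le _ ?_ _
  rw [norm_act]
  exact (norm_cmat_le _).trans h2

lemma norm_toState_le (f : S.L2) : ‖S.toState f‖ ≤ √S.normHam * ‖f‖ := by
  refine le_of_sq_le_sq ?_ (by positivity)
  rw [mul_pow, Real.sq_sqrt S.normHam_nonneg]
  calc ‖S.toState f‖ ^ 2 = RCLike.re (inner ℂ f (S.hamOp f)) := by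
        rw [← inner_self_eq_norm_sq (𝕜 := ℂ), energy_inner_def, LinearEquiv.symm_apply_apply]
    _ ≤ ‖f‖ * ‖S.hamOp f‖ := (RCLike.re_le_norm _).trans (norm_inner_le_norm _ _)
    _ ≤ ‖f‖ * (S.normHam * ‖f‖) := by gcongr; exact S.norm_hamOp_le f
    _ = S.normHam * ‖f‖ ^ 2 := by ring

/-- By duality: multiplication by `Ham`, from the energy space to `L²`, is the adjoint of the
identity from `L²` to the energy space, so it inherits the bound of `norm_toState_le`. One square
root on each side of the resolvent yields a single factor `‖Ham‖_∞`. -/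
lemma norm_hamOp_le_energy (u : S.L2) : ‖S.hamOp u‖ ≤ √S.normHam * ‖S.toState u‖ := by
  have h1 : ‖S.hamOp u‖ ^ 2 = RCLike.re (inner ℂ (S.toState u) (S.toState (S.hamOp u))) := by
    rw [energy_inner_def, LinearEquiv.symm_apply_apply, LinearEquiv.symm_apply_apply,
      ← hamOp_symm, inner_self_eq_norm_sq]
  have h2 : ‖S.hamOp u‖ * ‖S.hamOp u‖ ≤ ‖S.hamOp u‖ * (√S.normHam * ‖S.toState u‖) := by
    calc ‖S.hamOp u‖ * ‖S.hamOp u‖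
        = RCLike.re (inner ℂ (S.toState u) (S.toState (S.hamOp u))) := by rw [← h1, sq]
      _ ≤ ‖S.toState u‖ * ‖S.toState (S.hamOp u)‖ :=
        (RCLike.re_le_norm _).trans (norm_inner_le_norm _ _)
      _ ≤ ‖S.toState u‖ * (√S.normHam * ‖S.hamOp u‖) := by gcongr; exact S.norm_toState_le _
      _ = ‖S.hamOp u‖ * (√S.normHam * ‖S.toState u‖) := by ring
  rcases (norm_nonneg (S.hamOp u)).eq_or_lt with h0 | h0
  · rw [← h0]
    positivity
  · exact le_of_mul_le_mul_left h2 h0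

/-! ### The resolvent -/

variable {S}

/-- The imaginary axis is invariant under `z ↦ -z`. -/
lemma mem_resolventSetOf_neg (hres : ∀ t : ℝ, Complex.I * (t : ℂ) ∈ resolventSetOf S.op) (t : ℝ) :
    Complex.I * (t : ℂ) ∈ resolventSetOf (-S.op) := by
  obtain ⟨R, hR⟩ := hres (-t)
  refine ⟨-R, IsResolvent.neg ?_⟩
  simpa using hR

/-- If `R` is a resolvent of `-op` at `z`, then `u = R F` solves `op u = F - z u`. -/
lemma mem_graph_of_isResolvent {z : ℂ} {R : S.StateSpace →L[ℂ] S.StateSpace}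
    (hR : IsResolvent (-S.op) z R) (F : S.StateSpace) : (R F, F - z • R F) ∈ S.graph := by
  obtain ⟨u, h1, h2⟩ := hR.2 F
  rw [← S.op_graph]
  have h3 := S.op.mem_graph u
  have h4 : S.op u = F - z • R F := by
    rw [LinearPMap.neg_apply, sub_neg_eq_add] at h2
    rw [← h1, ← h2, add_sub_cancel_left]
  rwa [h4, h1] at h3

lemma eq_zero_of_isResolvent {z : ℂ} {R : S.StateSpace →L[ℂ] S.StateSpace}
    (hR : IsResolvent (-S.op) z R) {u : S.StateSpace} (hu : (u, -(z • u)) ∈ S.graph) : u = 0 := by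
  rw [← S.op_graph, LinearPMap.mem_graph_iff] at hu
  obtain ⟨y, h1, h2⟩ := hu
  simp only at h1 h2
  have h3 := hR.1 y
  rw [← h1, ← h3]
  have : (-S.op) y = z • (y : S.StateSpace) := by
    rw [LinearPMap.neg_apply, h2, h1, neg_neg]
  rw [this, sub_self, map_zero]

lemma intervalIntegrable_of_memLp_two {w : ℝ → Cd d} (hw : MemLp w 2 S.μ) :
    IntervalIntegrable w volume S.a S.b :=
  S.intervalIntegrable_of_memLp hw (right_mem_Icc.2 S.hab.le)

lemma memLp_two_of_continuousOn {v : ℝ → Cd d} (hv : ContinuousOn v (Icc S.a S.b)) :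
    MemLp v 2 S.μ := by
  obtain ⟨M, hM⟩ := isCompact_Icc.exists_bound_of_continuousOn hv
  refine MemLp.of_bound ((hv.mono Ioo_subset_Icc_self).aestronglyMeasurable measurableSet_Ioo) M ?_
  filter_upwards [S.ae_mem] with x hx using hM x (Ioo_subset_Icc_self hx)

/-- A solution of the homogeneous equation that satisfies the boundary condition is an eigenvector,
and it vanishes where the resolvent exists. -/
lemma T_injective {t : ℝ} (h : Complex.I * (t : ℂ) ∈ resolventSetOf (-S.op)) {c : Cd d}
    (hc : act (S.T t) c = 0) : c = 0 := by
  obtain ⟨R, hR⟩ := h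
  obtain ⟨K, hK⟩ := S.exists_inv_bound
  set v : ℝ → Cd d := fun x => S.flow t x c with hv
  have hvc : ContinuousOn v (Icc S.a S.b) := S.continuousOn_flow_apply t c
  have hvL := memLp_two_of_continuousOn hvc
  set w : ℝ → Cd d := fun x => act (S.coeff t x) (v x) with hw
  have hwL : MemLp w 2 S.μ := by
    obtain ⟨L, hL⟩ := S.exists_norm_coeff_le t
    obtain ⟨M, hM⟩ := isCompact_Icc.exists_bound_of_continuousOn hvc
    have hi := S.intervalIntegrable_coeff_flow t c
    rw [intervalIntegrable_iff_integrableOn_Ioc_of_le S.hab.le,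
      integrableOn_Ioc_iff_integrableOn_Ioo] at hi
    refine MemLp.of_bound hi.aestronglyMeasurable (L * M) ?_
    filter_upwards [S.ae_mem] with x hx
    have h1 : ‖act (S.coeff t x)‖ ≤ L := by
      rw [norm_act]
      exact hL x hx
    exact (ContinuousLinearMap.le_of_opNorm_le _ h1 _).trans (mul_le_mul_of_nonneg_left
      (hM x (Ioo_subset_Icc_self hx)) ((norm_nonneg _).trans h1))
  set u : S.L2 := S.hamInvOp (hvL.toLp v) with hu
  have hHu : ∀ᵐ x ∂S.μ, v x = act (cmat (S.Ham x)) (u x) := by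
    have h1 := S.hamOp_hamInvOp (hvL.toLp v)
    filter_upwards [multOp_coe _ S.memLp_Ham u, hvL.coeFn_toLp] with x h2 h3
    rw [← h2, ← h3]
    conv_lhs => rw [← h1]
    rfl
  -- `u = Ham⁻¹ Φ c` satisfies `A u = -it u`, and its boundary condition is exactly `T c = 0`.
  have hgraph : (S.toState u, -((Complex.I * (t : ℂ)) • S.toState u)) ∈ S.graph := by
    refine ⟨v, w, ⟨hwL, S.flow_eq_add_integral t c⟩, hHu, ?_, ?_⟩
    · rw [bdry_condition_iff]
      simp only [hv]
      rw [S.flow_left t c, ← act_T, hc]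
    · rw [← map_smul, ← map_neg, LinearEquiv.symm_apply_apply]
      filter_upwards [Lp.coeFn_neg ((Complex.I * (t : ℂ)) • u), Lp.coeFn_smul (Complex.I * (t : ℂ)) u,
        hHu, S.ae_mem] with x h1 h2 h3 hx
      rw [h1, Pi.neg_apply, h2, Pi.smul_apply]
      simp only [hw]
      rw [act_P1_act_coeff]
      have : act (cmat (S.Ham x)⁻¹) (v x) = u x := by
        rw [h3, ← act_mul_apply, ← cmat_mul,
          Matrix.nonsing_inv_mul _ ((Matrix.isUnit_iff_isUnit_det _).1 (hK x hx).1), cmat_one,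
          act_one_apply]
      rw [this]
      abel
  have hu0 : u = 0 := by simpa using eq_zero_of_isResolvent hR hgraph
  have hv0 : v =ᵐ[S.μ] 0 := by
    filter_upwards [hHu, Lp.coeFn_zero (Cd d) 2 S.μ] with x h1 h2
    rw [h1, hu0, h2]
    simp
  -- Continuity upgrades the vanishing almost everywhere to the endpoint `a`, where `v(a) = c`.
  have hvI : EqOn v 0 (Icc S.a S.b) := by
    refine Measure.eqOn_Icc_of_ae_eq volume S.hab.ne ?_ hvc continuousOn_const
    rwa [Measure.restrict_congr_set Ioo_ae_eq_Icc.symm]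
  have := hvI (left_mem_Icc.2 S.hab.le)
  simp only [hv] at this
  rwa [S.flow_left t c] at this

lemma isUnit_T {t : ℝ} (h : Complex.I * (t : ℂ) ∈ resolventSetOf (-S.op)) : IsUnit (S.T t) := by
  rw [← Matrix.mulVec_injective_iff_isUnit]
  refine (injective_iff_map_eq_zero (S.T t).mulVecLin).2 fun c hc => ?_
  have := T_injective h (c := WithLp.toLp 2 c) (by
    refine WithLp.ofLp_injective 2 ?_
    simpa [act, Matrix.ofLp_toEuclideanCLM] using hc)
  simpa using this

lemma act_inv_act_T {t : ℝ} (h : IsUnit (S.T t)) (c : Cd d) : act (S.T t)⁻¹ (act (S.T t) c) = c := by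
  rw [← act_mul_apply, Matrix.nonsing_inv_mul _ ((Matrix.isUnit_iff_isUnit_det _).1 h),
    act_one_apply]

/-- Green's formula for the resolvent. -/
lemma hamOp_resolvent_eq {t : ℝ} {R : S.StateSpace →L[ℂ] S.StateSpace}
    (hR : IsResolvent (-S.op) (Complex.I * (t : ℂ)) R) {f : ℝ → Cd d} (hf : MemLp f 2 S.μ) :
    ∀ᵐ x ∂S.μ, S.hamOp (S.toState.symm (R (S.toState (hf.toLp f)))) x
      = S.flow t x (act (S.T t)⁻¹ (act S.Wa (S.duhamel t f S.a x)
        - act S.Wb (S.flow t S.b (S.duhamel t f x S.b)))) := by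
  obtain ⟨K, hK⟩ := S.exists_inv_bound
  have hT := isUnit_T ⟨R, hR⟩
  obtain ⟨v, w, ⟨hw, hv⟩, h1, h2, h3⟩ := mem_graph_of_isResolvent hR (S.toState (hf.toLp f))
  rw [bdry_condition_iff] at h2
  rw [map_sub, map_smul, LinearEquiv.symm_apply_apply] at h3
  simp only at h1
  set u := S.toState.symm (R (S.toState (hf.toLp f))) with hu
  have hwi := intervalIntegrable_of_memLp_two hw
  have hfi := intervalIntegrable_of_memLp_two hf
  have hwf : ∀ᵐ x ∂S.μ, w x = act (S.coeff t x) (v x) + act (cmat S.P1⁻¹) (f x) := by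
    filter_upwards [h1, h3, Lp.coeFn_sub (hf.toLp f) ((Complex.I * (t : ℂ)) • u),
      Lp.coeFn_smul (Complex.I * (t : ℂ)) u, hf.coeFn_toLp, S.ae_mem] with x e1 e2 e3 e4 e5 hx
    rw [e3, Pi.sub_apply, e4, Pi.smul_apply, e5] at e2
    have e6 : act (cmat (S.Ham x)⁻¹) (v x) = u x := by
      rw [e1, ← act_mul_apply, ← cmat_mul,
        Matrix.nonsing_inv_mul _ ((Matrix.isUnit_iff_isUnit_det _).1 (hK x hx).1), cmat_one,
        act_one_apply]
    -- The resolvent equation solved for `P₁ v'`; inverting `P₁` gives the inhomogeneous equation.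
    have e7 : act (cmat S.P1) (w x)
        = -((Complex.I * (t : ℂ)) • u x + act (cmat S.P0) (v x)) + f x := by
      rw [← add_left_inj (act (cmat S.P0) (v x)), ← e2]
      abel
    rw [← S.act_inv_act_P1 (w x), e7, map_add, act_coeff, e6, map_neg]
  have hvar := S.eq_flow_add_duhamel hwi hfi hv hwf
  have hdi := S.intervalIntegrable_duhamel t hfi
  have ha := left_mem_Icc.2 S.hab.le
  have hb := right_mem_Icc.2 S.hab.le
  have hadd : ∀ x ∈ Icc S.a S.b,
      S.duhamel t f S.a S.b = S.duhamel t f S.a x + S.duhamel t f x S.b := fun x hx =>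
    (intervalIntegral.integral_add_adjacent_intervals (intervalIntegrable_of_mem_Icc hdi ha hx)
      (intervalIntegrable_of_mem_Icc hdi hx hb)).symm
  filter_upwards [h1, multOp_coe _ S.memLp_Ham u, S.ae_mem] with x e1 e2 hx
  have hx' := Ioo_subset_Icc_self hx
  rw [hamOp, e2, ← e1, hvar x hx']
  congr 1
  -- Put `c = v(a) + D(a,x)`. Then `v(a) = c - D(a,x)` and `v(b) = Φ(b) (c + D(x,b))`, so the
  -- boundary condition becomes `T c = Wa D(a,x) - Wb Φ(b) D(x,b)`.
  rw [← act_inv_act_T hT (v S.a + S.duhamel t f S.a x)]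
  congr 1
  rw [hvar S.b hb, hadd x hx'] at h2
  simp only [map_add] at h2
  rw [act_T]
  simp only [map_add]
  rw [← sub_eq_zero, ← h2]
  abel

end System

namespace System

variable {S : System d}

/-! ### Comparison of `L¹`, `L²` and `L^∞` norms -/

/-- Cauchy–Schwarz against the constant function 1. -/
lemma integral_norm_le_sqrt_mul (g : S.L2) {r s : ℝ} (hr : S.a ≤ r) (hrs : r ≤ s) (hs : s ≤ S.b) :
    ∫ x in r..s, ‖g x‖ ≤ √(s - r) * ‖g‖ := by
  have hsub : Ioo r s ⊆ Ioo S.a S.b := Ioo_subset_Ioo hr hs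
  have hg : MemLp g 2 (volume.restrict (Ioo r s)) :=
    (Lp.memLp g).mono_measure (Measure.restrict_mono hsub le_rfl)
  rw [intervalIntegral.integral_of_le hrs, ← integral_Ioc_eq_integral_Ioo.symm,
    integral_norm_eq_lintegral_enorm hg.1, ← eLpNorm_one_eq_lintegral_enorm, Lp.norm_def,
    mul_comm, Real.sqrt_eq_rpow]
  have h1 := eLpNorm_le_eLpNorm_mul_rpow_measure_univ (p := 1) (q := 2)
    (μ := volume.restrict (Ioo r s)) (by norm_num) hg.1
  have h2 : eLpNorm g 2 (volume.restrict (Ioo r s)) ≤ eLpNorm g 2 S.μ :=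
    eLpNorm_mono_measure _ (Measure.restrict_mono hsub le_rfl)
  have h3 : (volume.restrict (Ioo r s)) univ = ENNReal.ofReal (s - r) := by simp
  have h4 : (1 / (1 : ℝ≥0∞).toReal - 1 / (2 : ℝ≥0∞).toReal) = (1 / 2 : ℝ) := by norm_num
  rw [h3, h4] at h1
  have h5 := ENNReal.toReal_mono (ENNReal.mul_ne_top (Lp.memLp g).2.ne
    (ENNReal.rpow_ne_top_of_nonneg (y := (1 / 2 : ℝ)) (by norm_num)
      (ENNReal.ofReal_ne_top (r := s - r)))) (h1.trans (by gcongr))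
  rwa [ENNReal.toReal_mul, ← ENNReal.toReal_rpow, ENNReal.toReal_ofReal (sub_nonneg.2 hrs)] at h5

lemma norm_toLp_indicator_le {g : ℝ → Cd d} {r s M : ℝ} (hrs : r ≤ s) (hM0 : 0 ≤ M)
    (hM : ∀ x ∈ Icc S.a S.b, ‖g x‖ ≤ M) (hg : MemLp ((Ioc r s).indicator g) 2 S.μ) :
    ‖hg.toLp _‖ ≤ √(s - r) * M := by
  rw [Lp.norm_toLp, eLpNorm_indicator_eq_eLpNorm_restrict measurableSet_Ioc, Real.sqrt_eq_rpow]
  have h1 : eLpNorm g 2 (S.μ.restrict (Ioc r s))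
      ≤ (S.μ.restrict (Ioc r s)) univ ^ (2 : ℝ≥0∞).toReal⁻¹ * ENNReal.ofReal M := by
    refine eLpNorm_le_of_ae_bound ?_
    filter_upwards [ae_restrict_of_ae S.ae_mem] with x hx using hM x (Ioo_subset_Icc_self hx)
  have h2 : (S.μ.restrict (Ioc r s)) univ ≤ ENNReal.ofReal (s - r) := by
    rw [Measure.restrict_apply_univ, ← Real.volume_Ioc]
    exact Measure.restrict_apply_le _ _
  have h3 := ENNReal.toReal_mono (ENNReal.mul_ne_top
    (ENNReal.rpow_ne_top_of_nonneg (y := (2 : ℝ≥0∞).toReal⁻¹) (by norm_num)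
      (ENNReal.ofReal_ne_top (r := s - r))) (ENNReal.ofReal_ne_top (r := M)))
    (h1.trans (by gcongr))
  rw [ENNReal.toReal_mul, ← ENNReal.toReal_rpow, ENNReal.toReal_ofReal (sub_nonneg.2 hrs),
    ENNReal.toReal_ofReal hM0] at h3
  simpa using h3

lemma norm_le_sqrt_mul_of_ae_bound (g : S.L2) {M : ℝ} (hM0 : 0 ≤ M)
    (hM : ∀ᵐ x ∂S.μ, ‖g x‖ ≤ M) : ‖g‖ ≤ √(S.b - S.a) * M := by
  have h := Lp.norm_le_of_ae_bound hM0 hM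
  have h1 : ((measureUnivNNReal S.μ : NNReal) : ℝ) = S.b - S.a := by
    rw [measureUnivNNReal, ENNReal.coe_toNNReal_eq_toReal, Measure.restrict_apply_univ,
      Real.volume_Ioo, ENNReal.toReal_ofReal (sub_nonneg.2 S.hab.le)]
  rw [h1] at h
  rw [Real.sqrt_eq_rpow]
  simpa using h

/-! ### Constants -/

/-- The identity matrix has norm 1 only in positive dimension, hence `NeZero d`. -/
lemma one_le_P1_mul_inv [NeZero d] : 1 ≤ ‖S.P1‖ * ‖S.P1⁻¹‖ := by
  rw [← CStarRing.norm_one (E := Matrix (Fin d) (Fin d) ℝ),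
    ← Matrix.mul_nonsing_inv _ ((Matrix.isUnit_iff_isUnit_det _).1 S.P1_inv)]
  exact norm_mul_le _ _

lemma one_le_B [NeZero d] (hB : S.ConditionB) : 1 ≤ S.B := by
  have ha := left_mem_Icc.2 S.hab.le
  have h := S.norm_flow_le hB 0 ha
  have h1 : S.fund 0 S.a = 1 := by
    rw [(S.fund_spec 0).2 S.a ha]
    simp
  rwa [norm_act, h1, CStarRing.norm_one] at h

/-! ### The resolvent is bounded by the inverse of the boundary matrix -/

lemma norm_duhamel_le (hB : S.ConditionB) (t : ℝ) {f : ℝ → Cd d}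
    (hf : IntervalIntegrable f volume S.a S.b) {x y : ℝ} (hx : x ∈ Icc S.a S.b)
    (hy : y ∈ Icc S.a S.b) (hxy : x ≤ y) :
    ‖S.duhamel t f x y‖ ≤ ‖S.P1⁻¹‖ * S.B * ∫ s in x..y, ‖f s‖ := by
  rw [← intervalIntegral.integral_const_mul]
  refine intervalIntegral.norm_integral_le_of_norm_le hxy (ae_of_all _ fun s hs => ?_)
    ((intervalIntegrable_of_mem_Icc hf hx hy).norm.const_mul _)
  exact S.norm_duhamel_integrand_le hB t f ⟨hx.1.trans hs.1.le, hs.2.trans hy.2⟩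

/-- Green's formula gives a pointwise bound by `∫ ‖f‖`. One `√(b - a)` comes from the passage from
`L^∞` to `L²`, the other from `L²` to `L¹`. -/
lemma norm_resolvent_apply_le [NeZero d] (hB : S.ConditionB) {t : ℝ}
    {R : S.StateSpace →L[ℂ] S.StateSpace} (hR : IsResolvent (-S.op) (Complex.I * (t : ℂ)) R)
    (f : S.L2) : ‖S.hamOp (S.toState.symm (R (S.toState f)))‖
      ≤ (S.b - S.a) * (S.B ^ 3 * ‖S.W‖ * ‖S.P1⁻¹‖ * ‖(S.T t)⁻¹‖) * ‖f‖ := by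
  have hB1 := one_le_B hB
  have hB0 := S.B_nonneg
  have hba : 0 ≤ S.b - S.a := sub_nonneg.2 S.hab.le
  have hf := Lp.memLp f
  have hfi := intervalIntegrable_of_memLp_two hf
  have ha := left_mem_Icc.2 S.hab.le
  have hb := right_mem_Icc.2 S.hab.le
  have key := hamOp_resolvent_eq hR hf
  rw [Lp.toLp_coeFn] at key
  have hI := integral_norm_le_sqrt_mul f le_rfl S.hab.le le_rfl
  have hbound := norm_le_sqrt_mul_of_ae_bound (S := S)
    (S.hamOp (S.toState.symm (R (S.toState f))))
    (M := S.B * (‖(S.T t)⁻¹‖ * (‖S.W‖ * (S.B * (‖S.P1⁻¹‖ * S.B * (√(S.b - S.a) * ‖f‖))))))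
    (by positivity) (by
      filter_upwards [key, S.ae_mem] with x hx hxm
      have hx' := Ioo_subset_Icc_self hxm
      rw [hx]
      refine (ContinuousLinearMap.le_of_opNorm_le _ (S.norm_flow_le hB t hx') _).trans ?_
      gcongr
      refine (ContinuousLinearMap.le_of_opNorm_le _ (norm_act _).le _).trans ?_
      gcongr
      have i1 := norm_duhamel_le hB t hfi ha hx' hx'.1
      have i2 := norm_duhamel_le hB t hfi hx' hb hx'.2
      have i3 : ‖S.flow t S.b (S.duhamel t f x S.b)‖
          ≤ S.B * (‖S.P1⁻¹‖ * S.B * ∫ s in x..S.b, ‖f s‖) :=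
        (ContinuousLinearMap.le_of_opNorm_le _ (S.norm_flow_le hB t hb) _).trans (by gcongr)
      -- The superfluous factor `B ≥ 1` matches the term at `b`, so that the integrals over `(a,x)`
      -- and `(x,b)` add up to one over `(a,b)`.
      have i4 : ‖S.duhamel t f S.a x‖ ≤ S.B * (‖S.P1⁻¹‖ * S.B * ∫ s in S.a..x, ‖f s‖) := by
        refine i1.trans (le_mul_of_one_le_left ?_ hB1)
        exact mul_nonneg (by positivity)
          (intervalIntegral.integral_nonneg hx'.1 fun _ _ => norm_nonneg _)
      have i5 : (∫ s in S.a..x, ‖f s‖) + ∫ s in x..S.b, ‖f s‖ = ∫ s in S.a..S.b, ‖f s‖ :=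
        intervalIntegral.integral_add_adjacent_intervals
          (intervalIntegrable_of_mem_Icc hfi ha hx').norm
          (intervalIntegrable_of_mem_Icc hfi hx' hb).norm
      calc _ ≤ ‖S.W‖ * ‖S.duhamel t f S.a x‖ + ‖S.W‖ * ‖S.flow t S.b (S.duhamel t f x S.b)‖ :=
            (norm_sub_le _ _).trans (add_le_add (S.norm_act_Wa_le _) (S.norm_act_Wb_le _))
        _ ≤ ‖S.W‖ * (S.B * (‖S.P1⁻¹‖ * S.B * ∫ s in S.a..x, ‖f s‖))
            + ‖S.W‖ * (S.B * (‖S.P1⁻¹‖ * S.B * ∫ s in x..S.b, ‖f s‖)) := by gcongr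
        _ = ‖S.W‖ * (S.B * (‖S.P1⁻¹‖ * S.B * ∫ s in S.a..S.b, ‖f s‖)) := by
            rw [← i5]
            ring
        _ ≤ _ := by gcongr)
  refine hbound.trans (le_of_eq ?_)
  have hs := Real.mul_self_sqrt hba
  calc _ = (√(S.b - S.a) * √(S.b - S.a)) * (S.B ^ 3 * ‖S.W‖ * ‖S.P1⁻¹‖ * ‖(S.T t)⁻¹‖) * ‖f‖ := by
        ring
    _ = _ := by rw [hs]

/-- The `L²` estimate is framed by `isoS` on the left, as `u = Ham⁻¹ v`, and by `norm_le_isoS` on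
the right. -/
lemma norm_resolvent_le [NeZero d] (hB : S.ConditionB) {t : ℝ}
    {R : S.StateSpace →L[ℂ] S.StateSpace} (hR : IsResolvent (-S.op) (Complex.I * (t : ℂ)) R) :
    ‖R‖ ≤ ‖S.isoS‖ ^ 2 * ((S.b - S.a) * (S.B ^ 3 * ‖S.W‖ * ‖S.P1⁻¹‖ * ‖(S.T t)⁻¹‖)) := by
  have hB0 := S.B_nonneg
  have hba : 0 ≤ S.b - S.a := sub_nonneg.2 S.hab.le
  refine ContinuousLinearMap.opNorm_le_bound _ (by positivity) fun F => ?_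
  have h1 : R F = S.isoS (S.hamOp (S.toState.symm (R F))) := by
    rw [isoS_apply, hamInvOp_hamOp, LinearEquiv.apply_symm_apply]
  have h2 := norm_resolvent_apply_le hB hR (S.toState.symm F)
  have h3 := S.norm_le_isoS (S.toState.symm F)
  rw [LinearEquiv.apply_symm_apply] at h2 h3
  rw [h1]
  calc _ ≤ ‖S.isoS‖ * ‖S.hamOp (S.toState.symm (R F))‖ := S.isoS.le_opNorm _
    _ ≤ ‖S.isoS‖ * ((S.b - S.a) * (S.B ^ 3 * ‖S.W‖ * ‖S.P1⁻¹‖ * ‖(S.T t)⁻¹‖)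
          * (‖S.isoS‖ * ‖F‖)) := by gcongr; exact h2.trans (by gcongr)
    _ = _ := by ring

/-- The extra factor `‖P₁‖ ‖P₁⁻¹‖` in the constant is at least 1. -/
lemma norm_resolvent_le_constCtilde [NeZero d] (hB : S.ConditionB) {t : ℝ}
    {R : S.StateSpace →L[ℂ] S.StateSpace} (hR : IsResolvent (-S.op) (Complex.I * (t : ℂ)) R) :
    ‖R‖ ≤ S.constCtilde * (‖(S.T t)⁻¹‖ + 1) := by
  have hB0 := S.B_nonneg
  have hba : 0 ≤ S.b - S.a := sub_nonneg.2 S.hab.le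
  have hκ := one_le_P1_mul_inv (S := S)
  refine (norm_resolvent_le hB hR).trans ?_
  calc _ = (S.b - S.a) * S.B ^ 2 * ‖S.isoS‖ ^ 2 * ‖S.P1⁻¹‖ * (S.B * ‖S.W‖) * ‖(S.T t)⁻¹‖ * 1 := by
        ring
    _ ≤ (S.b - S.a) * S.B ^ 2 * ‖S.isoS‖ ^ 2 * ‖S.P1⁻¹‖
          * max (S.B * ‖S.W‖) ((S.b - S.a) ^ (1 / 2 : ℝ)) * (‖(S.T t)⁻¹‖ + 1)
          * (‖S.P1‖ * ‖S.P1⁻¹‖) := by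
        gcongr
        · exact le_max_left _ _
        · exact le_add_of_nonneg_right zero_le_one
    _ = _ := by
        rw [constCtilde]
        ring

/-! ### The inverse of the boundary matrix is bounded by the resolvent -/

/-- The response at `x` to a unit force at the left of `x`, transported to `a`. -/
def greenLeft (S : System d) (t : ℝ) (e : Cd d) : Cd d := act (S.T t)⁻¹ (act S.Wa e)

/-- The negative of the response at `x` to a unit force at the right of `x`, transported to `a`. -/
def greenRight (S : System d) (t : ℝ) (e : Cd d) : Cd d :=
  act (S.T t)⁻¹ (act S.Wb (S.flow t S.b e))

lemma greenLeft_add_greenRight {t : ℝ} (hT : IsUnit (S.T t)) (e : Cd d) :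
    S.greenLeft t e + S.greenRight t e = e := by
  rw [greenLeft, greenRight, ← map_add, add_comm, ← act_T, act_inv_act_T hT]

/-- The force is chosen so that `P₁⁻¹ Φ* (P₁ Φ e) = Φ⁻¹ Φ e = e`; the integral is then the length of
`(x,y] ∩ (r,s]` times `e`. -/
lemma duhamel_indicator {t : ℝ} (e : Cd d) {r s x y : ℝ} (hx : x ∈ Icc S.a S.b)
    (hy : y ∈ Icc S.a S.b) (hxy : x ≤ y) :
    S.duhamel t ((Ioc r s).indicator fun z => act (cmat S.P1) (S.flow t z e)) x y
      = max (min y s - max x r) 0 • e := by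
  have h1 : S.duhamel t ((Ioc r s).indicator fun z => act (cmat S.P1) (S.flow t z e)) x y
      = ∫ z in x..y, (Ioc r s).indicator (fun _ => e) z := by
    refine intervalIntegral.integral_congr fun z hz => ?_
    rw [uIcc_of_le hxy] at hz
    by_cases hzr : z ∈ Ioc r s
    · simp only [indicator_of_mem hzr]
      have := S.flowInv_flow t (Icc_subset_Icc hx.1 hy.2 hz) e
      rwa [flowInv, act_mul_apply, act_mul_apply] at this
    · simp [indicator_of_notMem hzr]
  rw [h1, intervalIntegral.integral_of_le hxy, integral_indicator measurableSet_Ioc,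
    Measure.restrict_restrict measurableSet_Ioc, setIntegral_const, inter_comm, Ioc_inter_Ioc,
    Measure.real, Real.volume_Ioc, ENNReal.toReal_ofReal']

/-- The integrand is `Φ⁻¹ v` for the force `P₁ Φ e` acting on `(r,s]`, and it is observed on
`(r',s')`. The two square roots come from the size of the force in `L²` and from Cauchy–Schwarz on
the observation interval. -/
lemma norm_integral_green_le (hB : S.ConditionB) {t : ℝ}
    {R : S.StateSpace →L[ℂ] S.StateSpace} (hR : IsResolvent (-S.op) (Complex.I * (t : ℂ)) R)
    (e : Cd d) {r s r' s' : ℝ} (hrs : r ≤ s) (hr' : S.a ≤ r') (hrs' : r' ≤ s') (hs' : s' ≤ S.b) :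
    ‖∫ x in r'..s', (max (min x s - max S.a r) 0 • S.greenLeft t e
        - max (min S.b s - max x r) 0 • S.greenRight t e)‖
      ≤ √(s' - r') * √(s - r) * (‖S.P1⁻¹‖ * S.B * ‖S.P1‖ * S.B * S.normHam * ‖R‖ * ‖S.P1‖)
        * ‖e‖ := by
  have hB0 := S.B_nonneg
  have ha := left_mem_Icc.2 S.hab.le
  have hb := right_mem_Icc.2 S.hab.le
  set g : ℝ → Cd d := fun z => act (cmat S.P1) (S.flow t z e) with hg
  have hgM : ∀ x ∈ Icc S.a S.b, ‖g x‖ ≤ ‖S.P1‖ * (S.B * ‖e‖) := by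
    intro x hx
    refine (ContinuousLinearMap.le_of_opNorm_le _ ((norm_act _).le.trans (norm_cmat_le _)) _).trans ?_
    gcongr
    exact ContinuousLinearMap.le_of_opNorm_le _ (S.norm_flow_le hB t hx) _
  have hgL : MemLp ((Ioc r s).indicator g) 2 S.μ :=
    (memLp_two_of_continuousOn ((act (cmat S.P1)).continuous.comp_continuousOn
      (S.continuousOn_flow_apply t e))).indicator measurableSet_Ioc
  set v : S.L2 := S.hamOp (S.toState.symm (R (S.toState (hgL.toLp _)))) with hv
  have key := hamOp_resolvent_eq hR hgL
  have hvn : ‖v‖ ≤ √S.normHam * (‖R‖ * (√S.normHam * (√(s - r) * (‖S.P1‖ * (S.B * ‖e‖))))) := by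
    refine (S.norm_hamOp_le_energy _).trans ?_
    rw [LinearEquiv.apply_symm_apply]
    gcongr
    refine (R.le_opNorm _).trans ?_
    gcongr
    refine (S.norm_toState_le _).trans ?_
    gcongr
    exact norm_toLp_indicator_le hrs (by positivity) hgM hgL
  have hvi := intervalIntegrable_of_memLp_two (Lp.memLp v)
  have h1 : ‖∫ x in r'..s', (max (min x s - max S.a r) 0 • S.greenLeft t e
        - max (min S.b s - max x r) 0 • S.greenRight t e)‖
      ≤ ∫ x in r'..s', ‖S.P1⁻¹‖ * S.B * ‖S.P1‖ * ‖v x‖ := by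
    refine intervalIntegral.norm_integral_le_of_norm_le hrs' ?_
      ((intervalIntegrable_of_mem_Icc hvi ⟨hr', hrs'.trans hs'⟩ ⟨hr'.trans hrs', hs'⟩).norm.const_mul _)
    rw [ae_restrict_iff' measurableSet_Ioo] at key
    -- `s'` may equal `b`, whereas Green's formula is available only inside `(a,b)`.
    have hne : ∀ᵐ x : ℝ, x ≠ s' := by simp [ae_iff, measure_singleton]
    filter_upwards [key, hne] with x hx hxs hxm
    have hx' : x ∈ Ioo S.a S.b :=
      ⟨hr'.trans_lt hxm.1, (lt_of_le_of_ne hxm.2 hxs).trans_le hs'⟩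
    have hx'' := Ioo_subset_Icc_self hx'
    have h2 := hx hx'
    rw [← hv, duhamel_indicator e ha hx'' hx''.1, duhamel_indicator e hx'' hb hx''.2] at h2
    have h3 : S.flowInv t x (v x) = max (min x s - max S.a r) 0 • S.greenLeft t e
        - max (min S.b s - max x r) 0 • S.greenRight t e := by
      rw [h2, S.flowInv_flow t hx'', greenLeft, greenRight, map_sub]
      simp only [ContinuousLinearMap.map_smul_of_tower]
    rw [← h3]
    exact ContinuousLinearMap.le_of_opNorm_le _ (S.norm_flowInv_le hB t hx'') _
  rw [intervalIntegral.integral_const_mul] at h1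
  have hh := Real.mul_self_sqrt S.normHam_nonneg
  calc _ ≤ ‖S.P1⁻¹‖ * S.B * ‖S.P1‖ * (√(s' - r') * ‖v‖) := by
        refine h1.trans ?_
        gcongr
        exact integral_norm_le_sqrt_mul v hr' hrs' hs'
    _ ≤ ‖S.P1⁻¹‖ * S.B * ‖S.P1‖ * (√(s' - r') * (√S.normHam * (‖R‖ * (√S.normHam
          * (√(s - r) * (‖S.P1‖ * (S.B * ‖e‖))))))) := by gcongr
    _ = √(s' - r') * √(s - r) * (‖S.P1⁻¹‖ * S.B * ‖S.P1‖ * S.B * (√S.normHam * √S.normHam) * ‖R‖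
          * ‖S.P1‖) * ‖e‖ := by ring
    _ = _ := by rw [hh]

/-- Three choices of force and observation intervals isolate `L e`, `R e` and `(L - R) e`. -/
lemma norm_green_le (hB : S.ConditionB) {t : ℝ}
    {R : S.StateSpace →L[ℂ] S.StateSpace} (hR : IsResolvent (-S.op) (Complex.I * (t : ℂ)) R)
    (e : Cd d) {N : ℝ}
    (hN : N = ‖S.P1⁻¹‖ * S.B * ‖S.P1‖ * S.B * S.normHam * ‖R‖ * ‖S.P1‖ / (S.b - S.a)) :
    ‖S.greenLeft t e‖ ≤ 2 * N * ‖e‖ ∧ ‖S.greenRight t e‖ ≤ 2 * N * ‖e‖ ∧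
      ‖S.greenLeft t e - S.greenRight t e‖ ≤ 2 * N * ‖e‖ := by
  have hab := S.hab
  have hl : 0 < S.b - S.a := sub_pos.2 hab
  set ℓ := S.b - S.a with hℓ
  have hN' : ‖S.P1⁻¹‖ * S.B * ‖S.P1‖ * S.B * S.normHam * ‖R‖ * ‖S.P1‖ = N * ℓ := by
    rw [hN]
    field_simp
  set m := (S.a + S.b) / 2 with hm
  have ham : S.a ≤ m := by rw [hm]; linarith
  have hmb : m ≤ S.b := by rw [hm]; linarith
  have hma : m - S.a = ℓ / 2 := by rw [hm, hℓ]; ring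
  have hbm : S.b - m = ℓ / 2 := by rw [hm, hℓ]; ring
  have hsq2 : √(ℓ / 2) * √(ℓ / 2) = ℓ / 2 := Real.mul_self_sqrt (by positivity)
  have hsq : √ℓ * √ℓ = ℓ := Real.mul_self_sqrt hl.le
  refine ⟨?_, ?_, ?_⟩
  -- Force on the left half, observation on the right half: only `L` contributes, with constant
  -- weight `ℓ / 2`.
  · have h := norm_integral_green_le hB hR e (r := S.a) (s := m) (r' := m) (s' := S.b)
      ham ham hmb le_rfl
    have h1 : ∫ x in m..S.b, (max (min x m - max S.a S.a) 0 • S.greenLeft t e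
        - max (min S.b m - max x S.a) 0 • S.greenRight t e)
        = ∫ x in m..S.b, (ℓ / 2) • S.greenLeft t e := by
      refine intervalIntegral.integral_congr fun x hx => ?_
      rw [uIcc_of_le hmb] at hx
      rw [min_eq_right hx.1, max_self, hma, max_eq_left (by positivity), min_eq_right hmb,
        max_eq_left (ham.trans hx.1), max_eq_right (sub_nonpos.2 hx.1), zero_smul, sub_zero]
    rw [h1, intervalIntegral.integral_const, smul_smul, norm_smul, hma, hbm, hsq2, hN',
      Real.norm_of_nonneg (by positivity)] at h
    have h2 : (ℓ / 2 * (ℓ / 2)) * ‖S.greenLeft t e‖ ≤ (ℓ / 2 * (ℓ / 2)) * (2 * N * ‖e‖) :=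
      h.trans (le_of_eq (by ring))
    exact le_of_mul_le_mul_left h2 (by positivity)
  -- Force on the right half, observation on the left half: only `R` contributes.
  · have h := norm_integral_green_le hB hR e (r := m) (s := S.b) (r' := S.a) (s' := m)
      hmb le_rfl ham hmb
    have h1 : ∫ x in S.a..m, (max (min x S.b - max S.a m) 0 • S.greenLeft t e
        - max (min S.b S.b - max x m) 0 • S.greenRight t e)
        = ∫ x in S.a..m, -((ℓ / 2) • S.greenRight t e) := by
      refine intervalIntegral.integral_congr fun x hx => ?_
      rw [uIcc_of_le ham] at hx
      rw [min_eq_left (hx.2.trans hmb), max_eq_right ham, max_eq_right (sub_nonpos.2 hx.2),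
        min_self, max_eq_right hx.2, hbm, max_eq_left (by positivity), zero_smul, zero_sub]
    rw [h1, intervalIntegral.integral_const, smul_neg, norm_neg, smul_smul, norm_smul, hma, hbm,
      hsq2, hN', Real.norm_of_nonneg (by positivity)] at h
    have h2 : (ℓ / 2 * (ℓ / 2)) * ‖S.greenRight t e‖ ≤ (ℓ / 2 * (ℓ / 2)) * (2 * N * ‖e‖) :=
      h.trans (le_of_eq (by ring))
    exact le_of_mul_le_mul_left h2 (by positivity)
  -- Force and observation on the whole interval: the weights `x - a` and `b - x` both integrate to
  -- `ℓ² / 2`.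
  · have h := norm_integral_green_le hB hR e (r := S.a) (s := S.b) (r' := S.a) (s' := S.b)
      hab.le le_rfl hab.le le_rfl
    have h1 : ∫ x in S.a..S.b, (max (min x S.b - max S.a S.a) 0 • S.greenLeft t e
        - max (min S.b S.b - max x S.a) 0 • S.greenRight t e)
        = ∫ x in S.a..S.b, ((x - S.a) • S.greenLeft t e - (S.b - x) • S.greenRight t e) := by
      refine intervalIntegral.integral_congr fun x hx => ?_
      rw [uIcc_of_le hab.le] at hx
      rw [min_eq_left hx.2, max_self, max_eq_left (sub_nonneg.2 hx.1), min_self,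
        max_eq_left hx.1, max_eq_left (sub_nonneg.2 hx.2)]
    have h3 : ∫ x in S.a..S.b, ((x - S.a) • S.greenLeft t e - (S.b - x) • S.greenRight t e)
        = (ℓ * ℓ / 2) • (S.greenLeft t e - S.greenRight t e) := by
      rw [intervalIntegral.integral_sub (Continuous.intervalIntegrable (by fun_prop) _ _)
        (Continuous.intervalIntegrable (by fun_prop) _ _), intervalIntegral.integral_smul_const,
        intervalIntegral.integral_smul_const, smul_sub]
      congr 2
      · rw [intervalIntegral.integral_sub (by simp) (by simp), integral_id,
          intervalIntegral.integral_const, smul_eq_mul, hℓ]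
        ring
      · rw [intervalIntegral.integral_sub (by simp) (by simp), integral_id,
          intervalIntegral.integral_const, smul_eq_mul, hℓ]
        ring
    rw [h1, h3, norm_smul, ← hℓ, hsq, hN', Real.norm_of_nonneg (by positivity)] at h
    have h2 : (ℓ * ℓ / 2) * ‖S.greenLeft t e - S.greenRight t e‖ ≤ (ℓ * ℓ / 2) * (2 * N * ‖e‖) :=
      h.trans (le_of_eq (by ring))
    exact le_of_mul_le_mul_left h2 (by positivity)

lemma norm_T_inv_le [NeZero d] (hB : S.ConditionB) {t : ℝ}
    {R : S.StateSpace →L[ℂ] S.StateSpace} (hR : IsResolvent (-S.op) (Complex.I * (t : ℂ)) R) :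
    ‖(S.T t)⁻¹‖ ≤ ‖S.Wplus‖ * (1 + ‖S.P1‖ ^ 2 * ‖S.P1⁻¹‖ ^ 2 * S.B ^ 3 * (1 + S.B)
      * (S.normHam * ‖S.P1‖ / (S.b - S.a)) * ‖R‖) := by
  have hT := isUnit_T ⟨R, hR⟩
  have hB1 := one_le_B hB
  have hB0 := S.B_nonneg
  have hh := S.normHam_nonneg
  have hl : 0 < S.b - S.a := sub_pos.2 S.hab
  have hb := right_mem_Icc.2 S.hab.le
  obtain ⟨N, hN⟩ : ∃ N, N = ‖S.P1⁻¹‖ * S.B * ‖S.P1‖ * S.B * S.normHam * ‖R‖ * ‖S.P1‖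
      / (S.b - S.a) := ⟨_, rfl⟩
  have hN0 : 0 ≤ N := by
    rw [hN]
    positivity
  obtain ⟨k, hk⟩ : ∃ k, k = ‖S.P1⁻¹‖ * S.B * ‖S.P1‖ := ⟨_, rfl⟩
  have hk1 : 1 ≤ k := by
    have := one_le_mul_of_one_le_of_one_le (one_le_P1_mul_inv (S := S)) hB1
    rw [hk]
    linarith
  have hgoal : ‖S.P1‖ ^ 2 * ‖S.P1⁻¹‖ ^ 2 * S.B ^ 3 * (1 + S.B)
      * (S.normHam * ‖S.P1‖ / (S.b - S.a)) * ‖R‖ = N * k * (1 + S.B) := by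
    rw [hN, hk]
    ring
  rw [hgoal]
  -- `M` is the smaller of `2N` and `1/2 + N`; the latter follows from `L + R = 1` and the bound of
  -- `L - R`. For `N ≤ 1/2` the last inequality is `2N ≤ 1`; otherwise it is `(N - 1/2)(k - 1) ≥ 0`.
  obtain ⟨M, hM0, hML, hMR, hMk⟩ : ∃ M : ℝ, 0 ≤ M ∧ (∀ e, ‖S.greenLeft t e‖ ≤ M * ‖e‖) ∧
      (∀ e, ‖S.greenRight t e‖ ≤ M * ‖e‖) ∧ M * (k + 1) ≤ 1 + N * k * 2 := by
    rcases le_total N (1 / 2) with h | h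
    · refine ⟨2 * N, by positivity, fun e => (norm_green_le hB hR e hN).1,
        fun e => (norm_green_le hB hR e hN).2.1, by nlinarith⟩
    · refine ⟨1 / 2 + N, by positivity, fun e => ?_, fun e => ?_, by nlinarith⟩
      · have h1 := (norm_green_le hB hR e hN).2.2
        have h2 : S.greenLeft t e
            = (1 / 2 : ℝ) • (S.greenLeft t e + S.greenRight t e
              + (S.greenLeft t e - S.greenRight t e)) := by module
        rw [greenLeft_add_greenRight hT e] at h2
        rw [h2, norm_smul, Real.norm_of_nonneg (by norm_num)]
        linarith [norm_add_le e (S.greenLeft t e - S.greenRight t e)]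
      · have h1 := (norm_green_le hB hR e hN).2.2
        have h2 : S.greenRight t e
            = (1 / 2 : ℝ) • (S.greenLeft t e + S.greenRight t e
              - (S.greenLeft t e - S.greenRight t e)) := by module
        rw [greenLeft_add_greenRight hT e] at h2
        rw [h2, norm_smul, Real.norm_of_nonneg (by norm_num)]
        linarith [norm_sub_le e (S.greenLeft t e - S.greenRight t e)]
  rw [← norm_act]
  refine ContinuousLinearMap.opNorm_le_bound _ (by positivity) fun y => ?_
  obtain ⟨zb, za, hy, hzb, hza⟩ := S.exists_boundary_values y
  -- Inserting `Φ(b) Φ(b)⁻¹` in front of `zb` expresses `T⁻¹ y` through `L` and `R`.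
  have h1 : act (S.T t)⁻¹ y = S.greenRight t (S.flowInv t S.b zb) + S.greenLeft t za := by
    rw [greenRight, greenLeft, S.flow_flowInv t hb, ← map_add, hy]
  have h2 : ‖S.flowInv t S.b zb‖ ≤ k * ‖zb‖ := by
    rw [hk]
    exact ContinuousLinearMap.le_of_opNorm_le _ (S.norm_flowInv_le hB t hb) _
  rw [h1]
  calc _ ≤ M * ‖S.flowInv t S.b zb‖ + M * ‖za‖ :=
        (norm_add_le _ _).trans (add_le_add (hMR _) (hML _))
    _ ≤ M * (k * (‖S.Wplus‖ * ‖y‖)) + M * (‖S.Wplus‖ * ‖y‖) := by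
        gcongr
        exact h2.trans (by gcongr)
    _ = ‖S.Wplus‖ * (M * (k + 1)) * ‖y‖ := by ring
    _ ≤ ‖S.Wplus‖ * (1 + N * k * (1 + S.B)) * ‖y‖ := by
        gcongr
        refine hMk.trans ?_
        gcongr
        -- `2 ≤ 1 + B`, since `B ≥ 1`.
        linarith

lemma norm_T_inv_le_constC [NeZero d] (hB : S.ConditionB) {t : ℝ}
    {R : S.StateSpace →L[ℂ] S.StateSpace} (hR : IsResolvent (-S.op) (Complex.I * (t : ℂ)) R) :
    ‖(S.T t)⁻¹‖ ≤ S.constC * (‖R‖ + 1) := by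
  have hB0 := S.B_nonneg
  have hh := S.normHam_nonneg
  have hl : 0 < S.b - S.a := sub_pos.2 S.hab
  refine (norm_T_inv_le hB hR).trans ?_
  set Q := ‖S.P1‖ ^ 2 * ‖S.P1⁻¹‖ ^ 2 * S.B ^ 3 * (1 + S.B) with hQ
  have hQ0 : 0 ≤ Q := by positivity
  set m := S.normHam * ‖S.P1‖ / (S.b - S.a) with hm
  have hm0 : 0 ≤ m := by positivity
  -- The power `-3/2` and the power `1/2` inside the maximum combine to the factor `1 / (b - a)` of
  -- `norm_T_inv_le`.
  have hpow : 1 / (S.b - S.a) ^ (3 / 2 : ℝ) * (S.b - S.a) ^ (1 / 2 : ℝ) = 1 / (S.b - S.a) := by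
    rw [show (3 / 2 : ℝ) = 1 + 1 / 2 by norm_num, Real.rpow_add hl, Real.rpow_one]
    have := (Real.rpow_pos_of_pos hl (1 / 2)).ne'
    field_simp
  have hD : 1 + Q * m ≤ (1 / (S.b - S.a) ^ (3 / 2 : ℝ) * Q + 1)
      * max ((S.b - S.a) ^ (1 / 2 : ℝ) * S.normHam * ‖S.P1‖) 1 := by
    have h1 : Q * m = 1 / (S.b - S.a) ^ (3 / 2 : ℝ) * Q
        * ((S.b - S.a) ^ (1 / 2 : ℝ) * S.normHam * ‖S.P1‖) := by
      calc Q * m = (1 / (S.b - S.a)) * Q * S.normHam * ‖S.P1‖ := by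
            rw [hm]
            ring
        _ = _ := by
            rw [← hpow]
            ring
    rw [add_mul, one_mul, add_comm, h1]
    gcongr
    · exact le_max_left _ _
    · exact le_max_right _ _
  calc ‖S.Wplus‖ * (1 + Q * m * ‖R‖)
      ≤ ‖S.Wplus‖ * ((1 + Q * m) * (‖R‖ + 1)) := by
        gcongr
        nlinarith [norm_nonneg R, mul_nonneg hQ0 hm0]
    _ ≤ ‖S.Wplus‖ * ((1 / (S.b - S.a) ^ (3 / 2 : ℝ) * Q + 1)
          * max ((S.b - S.a) ^ (1 / 2 : ℝ) * S.normHam * ‖S.P1‖) 1 * (‖R‖ + 1)) := by gcongr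
    _ = _ := by
        rw [constC, hQ]
        ring

end System

/-! ### Signs of the constants and the case of dimension zero. -/

namespace System

lemma constC_nonneg (S : System d) : 0 ≤ S.constC := by
  have := S.B_nonneg
  have := S.hab
  have : 0 ≤ S.b - S.a := by linarith
  rw [constC]
  positivity

lemma constCtilde_nonneg (S : System d) : 0 ≤ S.constCtilde := by
  have := S.B_nonneg
  have := S.hab
  have : 0 ≤ S.b - S.a := by linarith
  rw [constCtilde]
  positivity

lemma subsingleton_stateSpace (S : System 0) : Subsingleton S.StateSpace := by
  refine ⟨fun u v => S.toState.symm.injective (Lp.ext (ae_of_all _ fun x => ?_))⟩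
  exact Subsingleton.elim _ _

end System

end PortHam

end

theorem theorem4p1 {d : ℕ} (S : PortHam.System d) (hacc : S.IsAccretive)
    (hres : ∀ t : ℝ, Complex.I * (t : ℂ) ∈ PortHam.resolventSetOf S.op)
    (hB : S.ConditionB) (t : ℝ) :
    IsUnit (S.T t) ∧
      ‖(S.T t)⁻¹‖ ≤ S.constC * (‖PortHam.resolventOp (-S.op) (Complex.I * (t : ℂ))‖ + 1) ∧
      ‖PortHam.resolventOp (-S.op) (Complex.I * (t : ℂ))‖ ≤ S.constCtilde * (‖(S.T t)⁻¹‖ + 1) := by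
  have hmem := PortHam.System.mem_resolventSetOf_neg hres t
  have hR := PortHam.resolventOp_spec hmem
  refine ⟨PortHam.System.isUnit_T hmem, ?_⟩
  -- In dimension zero the bounds `1 ≤ B` and `1 ≤ ‖P₁‖ ‖P₁⁻¹‖` fail, but `T⁻¹` and the resolvent
  -- are both zero.
  rcases Nat.eq_zero_or_pos d with rfl | hd
  · have h1 := S.constC_nonneg
    have h2 := S.constCtilde_nonneg
    have := S.subsingleton_stateSpace
    refine ⟨?_, ?_⟩
    · rw [Subsingleton.elim (S.T t)⁻¹ 0, norm_zero]
      positivity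
    · rw [show PortHam.resolventOp (-S.op) (Complex.I * (t : ℂ)) = 0 from
        ContinuousLinearMap.ext fun _ => Subsingleton.elim _ _, norm_zero]
      positivity
  · have : NeZero d := ⟨hd.ne'⟩
    exact ⟨PortHam.System.norm_T_inv_le_constC hB hR,
      PortHam.System.norm_resolvent_le_constCtilde hB hR⟩
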